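/- **Quantum graphs.** A quantum graph $\Gamma$ consists of finite sets $V$ of vertices and $E$ of edges (no loops, parallel edges allowed); every edge $e$ is identified with a segment $[0,l_e]$, $l_e>0$, and joins two distinct vertices; at each vertex $v$ there is a linear boundary condition $A_v f|_v+B_v f'|_v=0$, where $A_v,B_v$ are complex matrices with equally many rows and with columns indexed by the set $E_v$ of edges incident to $v$, $f|_v$ is the vector of values at $v$ and $f'|_v$ the vector of outgoing derivatives at $v$ along these edges. For $\lambda\in\mathbb C$ let $\Phi_\Gamma(\lambda)$ be the space of functions $f=(f|_e)_{e\in E}$ with $f|_e\in W^{2,2}([0,l_e])$, $-f''=\lambda f$ on every edge, which satisfy all boundary conditions. Two quantum graphs $\Gamma_1,\Gamma_2$ are *transplantable* if there is a linear map $T$ from functions on $\Gamma_1$ to functions on $\Gamma_2$ which expresses the restriction of $Tf$ to each edge of $\Gamma_2$ as a fixed linear combination of restrictions of $f$ to edges of $\Gamma_1$ of the same length (each edge of both graphs being traversed in a direction chosen once and for all) and which, for every $\lambda\in\mathbb C$, maps $\Phi_{\Gamma_1}(\lambda)$ bijectively onto $\Phi_{\Gamma_2}(\lambda)$. **Actions.**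 A finite group $G$ acts on $\Gamma$ if it acts on $V$ and on $E$, preserving incidence, lengths and boundary conditions, and carries no vertex to one of its neighbours. **The quotient $\Gamma/R$.** Let $H$ be a finite group acting on $\Gamma$ and $R$ a $d$-dimensional complex representation of $H$ with structure homomorphism $\rho$. Choose representatives $\tilde e^i$ of the $H$-orbits of edges and $\tilde v_k$ of the $H$-orbits of vertices, and a basis $B=(b_j)$ of $R$. Let $d_i$ be the dimension of the space of vectors fixed by the stabilizer $H_{\tilde e^i}$, and choose for each $i$ a basis $B^i$ of $R$ whose first $d_i$ vectors are a basis of this space and whose other vectors lie in the sum of the non-trivial isotypic components of $\mathrm{Res}^H_{H_{\tilde e^i}}R$. The graph $\Gamma/R$ has the vertices $v_k$ and the edges $e^i_j$, $1\le j\le d_i$, of length $l_{\tilde e^i}$; $e^i_j$ joins $v_k$ and $v_{k'}$, where the ends of $\tilde e^i$ lie in the orbits of $\tilde v_k$ and $\tilde v_{k'}$. Write $E_{\tilde v_k}=\{g_l\tilde e^{\nu_l}\}_{l=1}^n$ with $g_l\in H$. Then $$A_{v_k}=(A_{\tilde v_k}\otimes I_d)\,\mathrm{diag}\big([\rho(g_1^{-1})]^B_{B^{\nu_1}},\dots,[\rho(g_n^{-1})]^B_{B^{\nu_n}}\big)^T\,\Theta,$$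 and $B_{v_k}$ is given by the same formula with $B_{\tilde v_k}$ in place of $A_{\tilde v_k}$. Here the $j$-th column of $[\rho(g^{-1})]^B_{B^\nu}$ consists of the coordinates of $\rho(g^{-1})b_j$ in the basis $B^\nu$, and $\Theta$ has the entry $1$ in row $(l,j')$ and column $e^i_j$ if $\nu_l=i$ and $j'=j$, and $0$ otherwise. Rows of $(A_{v_k}\,B_{v_k})$ may be eliminated as long as the row space does not change. **Claim.** Let a finite group $G$ act on a quantum graph $\Gamma$, let $H_1,H_2$ be subgroups of $G$, and let $R_1,R_2$ be finite-dimensional complex representations of $H_1,H_2$ such that $\mathrm{Ind}_{H_1}^G R_1\cong\mathrm{Ind}_{H_2}^G R_2$. Then any two quotient graphs $\Gamma/R_1$ and $\Gamma/R_2$ constructed as above, with arbitrary choices, are transplantable. -/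

import Mathlib

open MeasureTheory

noncomputable section

/-! ### Quantum graphs -/

/-- A quantum graph with vertex set `V` and edge set `E`. Every edge `e` is identified with the
segment `[0, len e]`, whose end `0` lies at the vertex `src e` and whose end `len e` lies at the
vertex `tgt e`. There are no loops; parallel edges are allowed. At each vertex `v` a homogeneous
boundary condition `A v · f|_v + B v · f'|_v = 0` is prescribed; the columns of `A v` and `B v` are
indexed by the edges incident to `v`. The number `rows v` of scalar conditions is arbitrary
(square matrices are the case where `rows v` is the degree of `v`). -/
structure QuantumGraph (V E : Type*) where
  src : E → V
  tgt : E → V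
  src_ne_tgt : ∀ e, src e ≠ tgt e
  len : E → ℝ
  len_pos : ∀ e, 0 < len e
  rows : V → ℕ
  A : ∀ v, Matrix (Fin (rows v)) {e : E // src e = v ∨ tgt e = v} ℂ
  B : ∀ v, Matrix (Fin (rows v)) {e : E // src e = v ∨ tgt e = v} ℂ

namespace QuantumGraph

variable {V E : Type*} (Γ : QuantumGraph V E)

/-- The set `E_v` of edges incident to the vertex `v`. -/
abbrev Incident (v : V) : Type _ := {e : E // Γ.src e = v ∨ Γ.tgt e = v}

instance [Finite E] (v : V) : Fintype (Γ.Incident v) := Fintype.ofFinite _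

/-- The boundary condition at `v`, for a vector `x` of vertex values and a vector `y` of outgoing
derivatives along the edges incident to `v` (the other entries of `x` and `y` are irrelevant). -/
def VertexCondition [Finite E] (v : V) (x y : E → ℂ) : Prop :=
  (Γ.A v).mulVec (fun e : Γ.Incident v => x e) + (Γ.B v).mulVec (fun e : Γ.Incident v => y e) = 0

/-- Functions on the graph: a function on the segment `[0, len e]` for each edge `e`. -/
abbrev Fun : Type _ := ∀ e : E, Set.Icc (0 : ℝ) (Γ.len e) → ℂ

/-- The restriction of `f` to the edge `e`, extended to all of `ℝ` by constants. -/
def restrict (f : Γ.Fun) (e : E) : ℝ → ℂ := Set.IccExtend (Γ.len_pos e).le (f e)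

/-- The derivative of `f` on the edge `e`, one-sided at the two ends. -/
def edgeDeriv (f : Γ.Fun) (e : E) (x : ℝ) : ℂ :=
  derivWithin (Γ.restrict f e) (Set.Icc 0 (Γ.len e)) x

/-- On the edge `e` the function `f` belongs to `W^{2,2}([0, len e])` and `h` is its second
derivative: `f` is differentiable, and its derivative is the indefinite integral of the
square-integrable function `h`. -/
def HasSecondDeriv (f : Γ.Fun) (e : E) (h : ℝ → ℂ) : Prop :=
  DifferentiableOn ℝ (Γ.restrict f e) (Set.Icc 0 (Γ.len e)) ∧
  MemLp h 2 (volume.restrict (Set.Icc 0 (Γ.len e))) ∧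
  ∀ x ∈ Set.Icc 0 (Γ.len e), Γ.edgeDeriv f e x = Γ.edgeDeriv f e 0 + ∫ t in (0 : ℝ)..x, h t

open Classical in
/-- The value `f|_e(v)` of `f` at the vertex `v` along an edge `e` incident to `v`. -/
def vertexValue (f : Γ.Fun) (v : V) (e : E) : ℂ :=
  if Γ.src e = v then Γ.restrict f e 0 else Γ.restrict f e (Γ.len e)

open Classical in
/-- The outgoing derivative `f'|_e(v)` of `f` at the vertex `v` along an edge `e` incident
to `v`. -/
def outDeriv (f : Γ.Fun) (v : V) (e : E) : ℂ :=
  if Γ.src e = v then Γ.edgeDeriv f e 0 else - Γ.edgeDeriv f e (Γ.len e)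

section helpers

variable {Γ}

theorem restrict_add (f g : Γ.Fun) (e : E) :
    Γ.restrict (f + g) e = Γ.restrict f e + Γ.restrict g e := rfl

theorem restrict_smul (c : ℂ) (f : Γ.Fun) (e : E) :
    Γ.restrict (c • f) e = c • Γ.restrict f e := rfl

theorem edgeDeriv_add {f g : Γ.Fun} {e : E}
    (hf : DifferentiableOn ℝ (Γ.restrict f e) (Set.Icc 0 (Γ.len e)))
    (hg : DifferentiableOn ℝ (Γ.restrict g e) (Set.Icc 0 (Γ.len e)))
    {x : ℝ} (hx : x ∈ Set.Icc 0 (Γ.len e)) :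
    Γ.edgeDeriv (f + g) e x = Γ.edgeDeriv f e x + Γ.edgeDeriv g e x := by
  unfold edgeDeriv
  rw [restrict_add]
  exact derivWithin_add (hf x hx) (hg x hx)

theorem edgeDeriv_smul {f : Γ.Fun} {e : E} (c : ℂ)
    (hf : DifferentiableOn ℝ (Γ.restrict f e) (Set.Icc 0 (Γ.len e)))
    {x : ℝ} (hx : x ∈ Set.Icc 0 (Γ.len e)) :
    Γ.edgeDeriv (c • f) e x = c * Γ.edgeDeriv f e x := by
  unfold edgeDeriv
  rw [restrict_smul, derivWithin_const_smul c (hf x hx), smul_eq_mul]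

theorem intervalIntegrable_of_memLp {l x : ℝ} {h : ℝ → ℂ}
    (hh : MemLp h 2 (volume.restrict (Set.Icc 0 l))) (hx : x ∈ Set.Icc 0 l) :
    IntervalIntegrable h volume 0 x := by
  rw [intervalIntegrable_iff_integrableOn_Icc_of_le hx.1]
  have : IntegrableOn h (Set.Icc 0 l) := hh.integrable (by norm_num)
  exact this.mono_set (Set.Icc_subset_Icc_right hx.2)

theorem HasSecondDeriv.add {f g : Γ.Fun} {e : E} {h k : ℝ → ℂ}
    (hf : Γ.HasSecondDeriv f e h) (hg : Γ.HasSecondDeriv g e k) :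
    Γ.HasSecondDeriv (f + g) e (h + k) := by
  refine ⟨?_, hf.2.1.add hg.2.1, fun x hx => ?_⟩
  · rw [restrict_add]
    exact hf.1.add hg.1
  · have h0 : (0 : ℝ) ∈ Set.Icc 0 (Γ.len e) := ⟨le_rfl, (Γ.len_pos e).le⟩
    rw [edgeDeriv_add hf.1 hg.1 hx, edgeDeriv_add hf.1 hg.1 h0, hf.2.2 x hx, hg.2.2 x hx]
    have := intervalIntegral.integral_add (intervalIntegrable_of_memLp hf.2.1 hx)
      (intervalIntegrable_of_memLp hg.2.1 hx)
    simp only [Pi.add_apply]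
    rw [this]
    ring

theorem HasSecondDeriv.smul {f : Γ.Fun} {e : E} {h : ℝ → ℂ} (c : ℂ)
    (hf : Γ.HasSecondDeriv f e h) : Γ.HasSecondDeriv (c • f) e (c • h) := by
  refine ⟨?_, hf.2.1.const_smul c, fun x hx => ?_⟩
  · rw [restrict_smul]
    exact hf.1.const_smul c
  · have h0 : (0 : ℝ) ∈ Set.Icc 0 (Γ.len e) := ⟨le_rfl, (Γ.len_pos e).le⟩
    rw [edgeDeriv_smul c hf.1 hx, edgeDeriv_smul c hf.1 h0, hf.2.2 x hx]
    simp only [Pi.smul_apply, smul_eq_mul, intervalIntegral.integral_const_mul]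
    ring

theorem vertexValue_add (f g : Γ.Fun) (v : V) (e : E) :
    Γ.vertexValue (f + g) v e = Γ.vertexValue f v e + Γ.vertexValue g v e := by
  unfold vertexValue
  split_ifs <;> rfl

theorem vertexValue_smul (c : ℂ) (f : Γ.Fun) (v : V) (e : E) :
    Γ.vertexValue (c • f) v e = c * Γ.vertexValue f v e := by
  unfold vertexValue
  split_ifs <;> rfl

theorem outDeriv_add {f g : Γ.Fun} {e : E} (v : V)
    (hf : DifferentiableOn ℝ (Γ.restrict f e) (Set.Icc 0 (Γ.len e)))
    (hg : DifferentiableOn ℝ (Γ.restrict g e) (Set.Icc 0 (Γ.len e))) :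
    Γ.outDeriv (f + g) v e = Γ.outDeriv f v e + Γ.outDeriv g v e := by
  unfold outDeriv
  split_ifs
  · exact edgeDeriv_add hf hg ⟨le_rfl, (Γ.len_pos e).le⟩
  · rw [edgeDeriv_add hf hg ⟨(Γ.len_pos e).le, le_rfl⟩]
    ring

theorem outDeriv_smul {f : Γ.Fun} {e : E} (c : ℂ) (v : V)
    (hf : DifferentiableOn ℝ (Γ.restrict f e) (Set.Icc 0 (Γ.len e))) :
    Γ.outDeriv (c • f) v e = c * Γ.outDeriv f v e := by
  unfold outDeriv
  split_ifs
  · exact edgeDeriv_smul c hf ⟨le_rfl, (Γ.len_pos e).le⟩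
  · rw [edgeDeriv_smul c hf ⟨(Γ.len_pos e).le, le_rfl⟩]
    ring

theorem VertexCondition.add [Finite E] {v : V} {x y x' y' : E → ℂ}
    (h : Γ.VertexCondition v x y) (h' : Γ.VertexCondition v x' y') :
    Γ.VertexCondition v (x + x') (y + y') := by
  unfold VertexCondition at *
  have e1 : (fun e : Γ.Incident v => (x + x') e)
      = (fun e : Γ.Incident v => x e) + (fun e : Γ.Incident v => x' e) := rfl
  have e2 : (fun e : Γ.Incident v => (y + y') e)
      = (fun e : Γ.Incident v => y e) + (fun e : Γ.Incident v => y' e) := rfl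
  rw [e1, e2, Matrix.mulVec_add, Matrix.mulVec_add, add_add_add_comm, h, h', add_zero]

theorem VertexCondition.smul [Finite E] {v : V} {x y : E → ℂ} (c : ℂ)
    (h : Γ.VertexCondition v x y) : Γ.VertexCondition v (c • x) (c • y) := by
  unfold VertexCondition at *
  have e1 : (fun e : Γ.Incident v => (c • x) e) = c • (fun e : Γ.Incident v => x e) := rfl
  have e2 : (fun e : Γ.Incident v => (c • y) e) = c • (fun e : Γ.Incident v => y e) := rfl
  rw [e1, e2, Matrix.mulVec_smul, Matrix.mulVec_smul, ← smul_add, h, smul_zero]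

end helpers

/-- `Φ_Γ(λ)`: the functions in `W^{2,2}(Γ)` which satisfy the boundary conditions at all vertices
and the equation `-f'' = λ f` on all edges. -/
def eigenspace [Finite E] (lam : ℂ) : Submodule ℂ Γ.Fun where
  carrier := {f |
    (∀ e, ∃ h, Γ.HasSecondDeriv f e h ∧
      ∀ᵐ x ∂(volume.restrict (Set.Icc 0 (Γ.len e))), - h x = lam * Γ.restrict f e x) ∧
    ∀ v, Γ.VertexCondition v (Γ.vertexValue f v) (Γ.outDeriv f v)}
  add_mem' := by
    rintro f g ⟨hf, hfv⟩ ⟨hg, hgv⟩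
    refine ⟨fun e => ?_, fun v => ?_⟩
    · obtain ⟨h, h1, h2⟩ := hf e
      obtain ⟨k, k1, k2⟩ := hg e
      refine ⟨h + k, h1.add k1, ?_⟩
      filter_upwards [h2, k2] with x hx kx
      rw [restrict_add, Pi.add_apply, Pi.add_apply, mul_add, ← hx, ← kx, neg_add]
    · have e1 : Γ.vertexValue (f + g) v = Γ.vertexValue f v + Γ.vertexValue g v :=
        funext fun e => vertexValue_add f g v e
      have e2 : Γ.outDeriv (f + g) v = Γ.outDeriv f v + Γ.outDeriv g v := by
        funext e
        obtain ⟨h, h1, -⟩ := hf e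
        obtain ⟨k, k1, -⟩ := hg e
        exact outDeriv_add v h1.1 k1.1
      rw [e1, e2]
      exact (hfv v).add (hgv v)
  zero_mem' := by
    have hr : ∀ e, Γ.restrict 0 e = fun _ => 0 := fun e => rfl
    have hd : ∀ e x, Γ.edgeDeriv 0 e x = 0 := fun e x => by
      unfold edgeDeriv
      rw [hr]
      simp
    refine ⟨fun e => ⟨0, ⟨?_, MemLp.zero, fun x _ => ?_⟩, ?_⟩, fun v => ?_⟩
    · rw [hr]
      exact differentiableOn_const _
    · simp [hd]
    · simp [hr]
    · have e1 : Γ.vertexValue 0 v = 0 := by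
        funext e
        unfold vertexValue
        simp [hr]
      have e2 : Γ.outDeriv 0 v = 0 := by
        funext e
        unfold outDeriv
        simp [hd]
      rw [e1, e2]
      unfold VertexCondition
      have : (fun e : Γ.Incident v => (0 : E → ℂ) e) = 0 := rfl
      rw [this, Matrix.mulVec_zero, Matrix.mulVec_zero, add_zero]
  smul_mem' := by
    rintro c f ⟨hf, hfv⟩
    refine ⟨fun e => ?_, fun v => ?_⟩
    · obtain ⟨h, h1, h2⟩ := hf e
      refine ⟨c • h, h1.smul c, ?_⟩
      filter_upwards [h2] with x hx
      rw [restrict_smul, Pi.smul_apply, Pi.smul_apply, smul_eq_mul, smul_eq_mul, ← mul_neg, hx]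
      ring
    · have e1 : Γ.vertexValue (c • f) v = c • Γ.vertexValue f v :=
        funext fun e => vertexValue_smul c f v e
      have e2 : Γ.outDeriv (c • f) v = c • Γ.outDeriv f v := by
        funext e
        obtain ⟨h, h1, -⟩ := hf e
        exact outDeriv_smul c v h1.1
      rw [e1, e2]
      exact (hfv v).smul c

/-! ### Transplantation -/

/-- The point of the edge `e` at distance `t` from the end `0` (if `r = false`) or from the end
`len e` (if `r = true`). -/
def directed (r : Bool) (e : E) (t : ℝ) : ℝ := if r then Γ.len e - t else t

/-- A linear map `T` from the functions on `Γ₁` to those on `Γ₂` is a transplantation if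
* it presents the restriction of `T f` to each edge of `Γ₂` as a fixed linear combination of the
  restrictions of `f` to edges of `Γ₁` of the same length (each edge of the two graphs being given
  one of its two directions once and for all), and
* for every `λ`, it maps the eigenspace `Φ_{Γ₁}(λ)` bijectively onto `Φ_{Γ₂}(λ)`. -/
def IsTransplantation {V₁ E₁ V₂ E₂ : Type*} [Fintype E₁] [Finite E₂]
    (Γ₁ : QuantumGraph V₁ E₁) (Γ₂ : QuantumGraph V₂ E₂) (T : Γ₁.Fun →ₗ[ℂ] Γ₂.Fun) : Prop :=
  (∃ (r₁ : E₁ → Bool) (r₂ : E₂ → Bool) (c : E₂ → E₁ → ℂ),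
    (∀ e₂ e₁, c e₂ e₁ ≠ 0 → Γ₁.len e₁ = Γ₂.len e₂) ∧
    ∀ (f : Γ₁.Fun) (e₂ : E₂), ∀ t ∈ Set.Icc 0 (Γ₂.len e₂),
      Γ₂.restrict (T f) e₂ (Γ₂.directed (r₂ e₂) e₂ t) =
        ∑ e₁, c e₂ e₁ * Γ₁.restrict f e₁ (Γ₁.directed (r₁ e₁) e₁ t)) ∧
  ∀ lam : ℂ, Set.BijOn T (Γ₁.eigenspace lam : Set Γ₁.Fun) (Γ₂.eigenspace lam)

/-- Two quantum graphs are transplantable if there is a transplantation between them. -/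
def Transplantable {V₁ E₁ V₂ E₂ : Type*} [Fintype E₁] [Finite E₂]
    (Γ₁ : QuantumGraph V₁ E₁) (Γ₂ : QuantumGraph V₂ E₂) : Prop :=
  ∃ T : Γ₁.Fun →ₗ[ℂ] Γ₂.Fun, IsTransplantation Γ₁ Γ₂ T

/-! ### Group actions -/

/-- The group `G` acts on the quantum graph `Γ`: it preserves the incidence relation, the lengths
and the boundary conditions (those at `g • v` are those at `v`, transported by `g`), and it carries
no vertex to one of its neighbours. -/
structure IsSymmetry [Finite E] (G : Type*) [Group G] [MulAction G V] [MulAction G E] : Prop where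
  ends_smul : ∀ (g : G) (e : E), s(Γ.src (g • e), Γ.tgt (g • e)) = s(g • Γ.src e, g • Γ.tgt e)
  len_smul : ∀ (g : G) (e : E), Γ.len (g • e) = Γ.len e
  vertexCondition_smul : ∀ (g : G) (v : V) (x y : E → ℂ),
    Γ.VertexCondition (g • v) x y ↔
      Γ.VertexCondition v (fun e => x (g • e)) (fun e => y (g • e))
  smul_src_ne_tgt : ∀ (g : G) (e : E), g • Γ.src e ≠ Γ.tgt e

theorem IsSymmetry.subgroup {Γ : QuantumGraph V E} [Finite E] {G : Type*} [Group G]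
    [MulAction G V] [MulAction G E] (h : Γ.IsSymmetry G) (H : Subgroup G) : Γ.IsSymmetry H where
  ends_smul g e := h.ends_smul g e
  len_smul g e := h.len_smul g e
  vertexCondition_smul g v x y := h.vertexCondition_smul g v x y
  smul_src_ne_tgt g e := h.smul_src_ne_tgt g e

end QuantumGraph

/-! ### Representations -/

/-- The sum of all non-trivial irreducible subrepresentations of `σ`, that is, the sum of the
isotypic components other than the trivial one. -/
def Representation.nontrivialPart {K W : Type*} [Group K] [AddCommGroup W] [Module ℂ W]
    (σ : Representation ℂ K W) : Submodule ℂ W :=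
  ⨆ S ∈ {S : Subrepresentation σ |
    S.toRepresentation.IsIrreducible ∧ ¬ S.toRepresentation.IsTrivial}, S.toSubmodule

/-- The restriction of a representation of `H` to the stabilizer of `e`. -/
def Representation.resStabilizer {H W E : Type*} [Group H] [AddCommGroup W] [Module ℂ W]
    [MulAction H E] (ρ : Representation ℂ H W) (e : E) :
    Representation ℂ (MulAction.stabilizer H e) W :=
  ρ.comp (MulAction.stabilizer H e).subtype

/-! ### The quotient graph -/

namespace QuantumGraph

variable {V E : Type*} (Γ : QuantumGraph V E)

/-- The choices made in the construction of the quotient `Γ/R`, where `R` is the representation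
`ρ` of `H` on `W`:
* representatives `ẽ^i` for the orbits of edges and `ṽ_k` for the orbits of vertices;
* a basis `B` of `W`;
* for each `i` a basis `B^i` of `W` whose first `d_i` vectors form a basis of the trivial component
  of the restriction of `R` to the stabilizer of `ẽ^i`, and whose other vectors lie in the sum of
  the other isotypic components;
* for each edge `e` incident to `ṽ_k` a group element `g` with `e = g ẽ^i`. -/
structure QuotientChoice {H W : Type*} [Group H] [MulAction H V] [MulAction H E]
    [AddCommGroup W] [Module ℂ W] (ρ : Representation ℂ H W) where
  edgeRep : MulAction.orbitRel.Quotient H E → E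
  mk_edgeRep : ∀ i, (Quotient.mk'' (edgeRep i) : MulAction.orbitRel.Quotient H E) = i
  vertexRep : MulAction.orbitRel.Quotient H V → V
  mk_vertexRep : ∀ k, (Quotient.mk'' (vertexRep k) : MulAction.orbitRel.Quotient H V) = k
  basis : Module.Basis (Fin (Module.finrank ℂ W)) ℂ W
  edgeBasis : MulAction.orbitRel.Quotient H E → Module.Basis (Fin (Module.finrank ℂ W)) ℂ W
  edgeBasis_mem_invariants : ∀ i (j : Fin (Module.finrank ℂ W)),
    (j : ℕ) < Module.finrank ℂ (ρ.resStabilizer (edgeRep i)).invariants →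
      edgeBasis i j ∈ (ρ.resStabilizer (edgeRep i)).invariants
  edgeBasis_mem_nontrivialPart : ∀ i (j : Fin (Module.finrank ℂ W)),
    Module.finrank ℂ (ρ.resStabilizer (edgeRep i)).invariants ≤ (j : ℕ) →
      edgeBasis i j ∈ (ρ.resStabilizer (edgeRep i)).nontrivialPart
  transporter : ∀ k, Γ.Incident (vertexRep k) → H
  transporter_smul : ∀ k (e : Γ.Incident (vertexRep k)),
    transporter k e • edgeRep (Quotient.mk'' e.1) = e.1

namespace QuotientChoice

variable {Γ} {H W : Type*} [Group H] [MulAction H V] [MulAction H E]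
  [AddCommGroup W] [Module ℂ W] {ρ : Representation ℂ H W} (c : Γ.QuotientChoice ρ)

/-- The number `d_i` of copies of the edge `ẽ^i` in the quotient. -/
def copies (i : MulAction.orbitRel.Quotient H E) : ℕ :=
  Module.finrank ℂ (ρ.resStabilizer (c.edgeRep i)).invariants

/-- The edges `e^i_j` of the quotient, `1 ≤ j ≤ d_i`. -/
abbrev Edge : Type _ := Σ i : MulAction.orbitRel.Quotient H E, Fin (c.copies i)

instance [Finite E] : Finite (MulAction.orbitRel.Quotient H E) :=
  inferInstanceAs (Finite (Quotient _))

instance [Finite E] : Fintype c.Edge := Fintype.ofFinite _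

/-- The vertex (an orbit of vertices of `Γ`) at the end `0` of `e^i_j`. -/
def edgeSrc (e : c.Edge) : MulAction.orbitRel.Quotient H V :=
  Quotient.mk'' (Γ.src (c.edgeRep e.1))

/-- The vertex (an orbit of vertices of `Γ`) at the other end of `e^i_j`. -/
def edgeTgt (e : c.Edge) : MulAction.orbitRel.Quotient H V :=
  Quotient.mk'' (Γ.tgt (c.edgeRep e.1))

/-- The edges of the quotient which are incident to the vertex `v_k`. -/
abbrev Incident (k : MulAction.orbitRel.Quotient H V) : Type _ :=
  {e : c.Edge // c.edgeSrc e = k ∨ c.edgeTgt e = k}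

open Classical in
/-- The block diagonal matrix `diag([ρ(g₁⁻¹)]_{B^{ν₁}}^B, …, [ρ(gₙ⁻¹)]_{B^{νₙ}}^B)ᵀ`, whose blocks
are indexed by the edges `g_l ẽ^{ν_l}` incident to `ṽ_k`. The `j`-th column of
`[ρ(g⁻¹)]_{B^ν}^B` consists of the coordinates of `ρ(g⁻¹) b_j` in the basis `B^ν`. -/
def repMatrix (k : MulAction.orbitRel.Quotient H V) :
    Matrix (Γ.Incident (c.vertexRep k) × Fin (Module.finrank ℂ W))
      (Γ.Incident (c.vertexRep k) × Fin (Module.finrank ℂ W)) ℂ :=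
  Matrix.transpose <| Matrix.of fun p q =>
    if p.1 = q.1 then
      LinearMap.toMatrix c.basis (c.edgeBasis (Quotient.mk'' p.1.1)) (ρ (c.transporter k p.1)⁻¹) p.2 q.2
    else 0

open Classical in
/-- The matrix `Θ`: the entry in the row `(l, j')` and the column `e^i_j` is `1` if `ν_l = i` and
`j' = j`, and `0` otherwise. -/
def theta (k : MulAction.orbitRel.Quotient H V) :
    Matrix (Γ.Incident (c.vertexRep k) × Fin (Module.finrank ℂ W)) (c.Incident k) ℂ :=
  Matrix.of fun p e =>
    if (Quotient.mk'' p.1.1 : MulAction.orbitRel.Quotient H E) = e.1.1 ∧ (p.2 : ℕ) = e.1.2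
    then 1 else 0

/-- `(M ⊗ I_d) · diag([ρ(g₁⁻¹)]_{B^{ν₁}}^B, …, [ρ(gₙ⁻¹)]_{B^{νₙ}}^B)ᵀ · Θ`. -/
def boundaryMatrix [Finite E] (k : MulAction.orbitRel.Quotient H V) {n : ℕ}
    (M : Matrix (Fin n) (Γ.Incident (c.vertexRep k)) ℂ) :
    Matrix (Fin n × Fin (Module.finrank ℂ W)) (c.Incident k) ℂ :=
  (Matrix.kroneckerMap (· * ·) M (1 : Matrix (Fin (Module.finrank ℂ W)) _ ℂ) :
    Matrix (Fin n × Fin (Module.finrank ℂ W))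
      (Γ.Incident (c.vertexRep k) × Fin (Module.finrank ℂ W)) ℂ) *
    c.repMatrix k * c.theta k

/-- The `p`-th row of the matrix `(A_{v_k} B_{v_k})`. -/
def boundaryRow [Finite E] (k : MulAction.orbitRel.Quotient H V)
    (p : Fin (Γ.rows (c.vertexRep k)) × Fin (Module.finrank ℂ W)) :
    (c.Incident k → ℂ) × (c.Incident k → ℂ) :=
  (c.boundaryMatrix k (Γ.A (c.vertexRep k)) p, c.boundaryMatrix k (Γ.B (c.vertexRep k)) p)

/-- A choice of the rows of `(A_{v_k} B_{v_k})` that are kept as the boundary conditions at `v_k`: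
rows may be eliminated as long as the remaining ones span the same space. -/
structure RowChoice [Finite E] where
  num : MulAction.orbitRel.Quotient H V → ℕ
  row : ∀ k, Fin (num k) ↪ Fin (Γ.rows (c.vertexRep k)) × Fin (Module.finrank ℂ W)
  span_eq : ∀ k, Submodule.span ℂ (Set.range fun r => c.boundaryRow k (row k r)) =
    Submodule.span ℂ (Set.range (c.boundaryRow k))

/-- The quotient graph `Γ/R` constructed from the choices `c` and `s`. -/
def quotientGraph [Finite E] (hΓ : Γ.IsSymmetry H) (s : c.RowChoice) :
    QuantumGraph (MulAction.orbitRel.Quotient H V) c.Edge where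
  src := c.edgeSrc
  tgt := c.edgeTgt
  src_ne_tgt e he := by
    obtain ⟨g, hg⟩ := MulAction.orbitRel_apply.mp (Quotient.exact he.symm)
    exact hΓ.smul_src_ne_tgt g _ hg
  len e := Γ.len (c.edgeRep e.1)
  len_pos e := Γ.len_pos _
  rows := s.num
  A k := (c.boundaryMatrix k (Γ.A (c.vertexRep k))).submatrix (s.row k) id
  B k := (c.boundaryMatrix k (Γ.B (c.vertexRep k))).submatrix (s.row k) id

end QuotientChoice

end QuantumGraph

end

/-! A function on the edges of Γ/R is the same thing as a linear map φ : W → ℂ^E with φ(ρ(h)w)(he) =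
φ(w)(e). Indeed φ is determined by the functionals w ↦ φ(w)(ẽ^i). Each is invariant under the
stabilizer of ẽ^i, hence vanishes on the non-trivial isotypic components and amounts to d_i numbers,
one for each edge e^i_j (`edgeEquiv`). Frobenius reciprocity (`frobeniusEquiv`) turns these φ into
the G-equivariant maps from Ind R to ℂ^E. An isomorphism of the induced representations therefore
yields a linear isomorphism L between the edge functions of the two quotients.

Everything relevant on the quotient can be read off from φ, so L respects it. Edge data satisfy the
conditions at v_k iff φ sends every w to data satisfying the conditions of Γ at ṽ_k, and then, by
equivariance, at the whole orbit (`vertexCondition_quotientGraph`, `endCondition_quotientGraph`).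
Multiplication by the edge length is G-invariant, so L commutes with it; its non-zero entries join
edges of equal length.

Combining restrictions with the coefficients of L preserves -u'' = λu for all λ at once and applies
L to end values and end derivatives; L⁻¹ gives the inverse (`transplantable_of_linearEquiv`).

Linear combinations of edge data make sense only for compatible directions. As no vertex is carried
to a neighbour, edge stabilizers fix both ends, so a G-invariant direction exists
(`exists_start_smul`). -/

noncomputable section

/-! ### Solutions of `-u'' = λ u` on a segment -/

/-- The function `u` solves `-u'' = lam * u` on `[0, l]`, in integrated form. -/
def IsSegmentSolution (l : ℝ) (lam : ℂ) (u : ℝ → ℂ) : Prop :=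
  DifferentiableOn ℝ u (Set.Icc 0 l) ∧
  ∀ x ∈ Set.Icc 0 l, derivWithin u (Set.Icc 0 l) x =
    derivWithin u (Set.Icc 0 l) 0 - lam * ∫ t in (0 : ℝ)..x, u t

namespace IsSegmentSolution

variable {l : ℝ} {lam : ℂ} {u v : ℝ → ℂ}

theorem intervalIntegrable (hu : DifferentiableOn ℝ u (Set.Icc 0 l)) {x y : ℝ}
    (hx : x ∈ Set.Icc 0 l) (hy : y ∈ Set.Icc 0 l) : IntervalIntegrable u volume x y :=
  (hu.continuousOn.mono (Set.uIcc_subset_Icc hx hy)).intervalIntegrable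

theorem congr (hu : IsSegmentSolution l lam u) (h : Set.EqOn v u (Set.Icc 0 l)) :
    IsSegmentSolution l lam v := by
  refine ⟨hu.1.congr h, fun x hx => ?_⟩
  have h0 : (0 : ℝ) ∈ Set.Icc 0 l := ⟨le_rfl, hx.1.trans hx.2⟩
  have hi : ∫ t in (0 : ℝ)..x, v t = ∫ t in (0 : ℝ)..x, u t :=
    intervalIntegral.integral_congr fun t ht => h (Set.uIcc_subset_Icc h0 hx ht)
  rw [derivWithin_congr h (h hx), derivWithin_congr h (h h0), hi, hu.2 x hx]

/-- Differentiability is asked only where the coefficient is non-zero: in a transplantation the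
other terms come from edges of different length, about which nothing is known on this segment. -/
theorem derivWithin_sum_mul {ι : Type*} [Fintype ι] {c : ι → ℂ} {w : ι → ℝ → ℂ} {s : Set ℝ}
    {x : ℝ} (h : ∀ i, c i ≠ 0 → DifferentiableWithinAt ℝ (w i) s x) :
    derivWithin (fun t => ∑ i, c i * w i t) s x = ∑ i, c i * derivWithin (w i) s x := by
  rw [derivWithin_fun_sum]
  · simp only [derivWithin_const_mul_field]
  · intro i _
    by_cases hi : c i = 0
    · simp [hi, differentiableWithinAt_const]
    · exact (h i hi).const_mul _

theorem sum_mul {ι : Type*} [Fintype ι] {c : ι → ℂ} {w : ι → ℝ → ℂ}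
    (h : ∀ i, c i ≠ 0 → IsSegmentSolution l lam (w i)) :
    IsSegmentSolution l lam (fun t => ∑ i, c i * w i t) := by
  have hd : ∀ i, DifferentiableOn ℝ (fun t => c i * w i t) (Set.Icc 0 l) := fun i => by
    by_cases hi : c i = 0
    · simp [hi, differentiableOn_const]
    · exact (h i hi).1.const_mul _
  refine ⟨DifferentiableOn.fun_sum fun i _ => hd i, fun x hx => ?_⟩
  have h0 : (0 : ℝ) ∈ Set.Icc 0 l := ⟨le_rfl, hx.1.trans hx.2⟩
  rw [derivWithin_sum_mul fun i hi => (h i hi).1 x hx,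
    derivWithin_sum_mul fun i hi => (h i hi).1 0 h0,
    intervalIntegral.integral_finsetSum fun i _ => intervalIntegrable (hd i) h0 hx,
    Finset.mul_sum, ← Finset.sum_sub_distrib]
  refine Finset.sum_congr rfl fun i _ => ?_
  by_cases hi : c i = 0
  · simp [hi]
  · rw [(h i hi).2 x hx, intervalIntegral.integral_const_mul]
    ring

theorem derivWithin_reverse (u : ℝ → ℂ) (l x : ℝ) :
    derivWithin (fun t => u (l - t)) (Set.Icc 0 l) x = - derivWithin u (Set.Icc 0 l) (l - x) := by
  rw [derivWithin_comp_const_sub]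
  congr 2
  ext t
  simp only [Set.mem_vadd_set, Set.mem_neg, vadd_eq_add, Set.mem_Icc]
  constructor
  · rintro ⟨y, hy, rfl⟩
    constructor <;> linarith
  · rintro ht
    exact ⟨t - l, by constructor <;> linarith, by ring⟩

/-- The equation is of second order, so the two signs produced by the reflection cancel; in
integrated form this is the splitting of the integral over [0, l] at l - x. -/
theorem reverse (hu : IsSegmentSolution l lam u) :
    IsSegmentSolution l lam (fun t => u (l - t)) := by
  refine ⟨?_, fun x hx => ?_⟩
  · refine hu.1.comp (by fun_prop) fun t ht => ?_
    exact ⟨by linarith [ht.2], by linarith [ht.1]⟩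
  have hl : 0 ≤ l := hx.1.trans hx.2
  have h1 : l - x ∈ Set.Icc 0 l := ⟨by linarith [hx.2], by linarith [hx.1]⟩
  have h0 : (0 : ℝ) ∈ Set.Icc 0 l := ⟨le_rfl, hl⟩
  have h2 : l ∈ Set.Icc 0 l := ⟨hl, le_rfl⟩
  have h3 := intervalIntegral.integral_add_adjacent_intervals
    (intervalIntegrable hu.1 h0 h1) (intervalIntegrable hu.1 h1 h2)
  rw [derivWithin_reverse, derivWithin_reverse, sub_zero, hu.2 _ h1, hu.2 _ h2,
    intervalIntegral.integral_comp_sub_left, sub_zero, ← h3]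
  ring

end IsSegmentSolution

namespace QuantumGraph

variable {V E : Type*} {Γ : QuantumGraph V E}

/-- The second derivative enters only through its integral, so it may be replaced by -λf. Conversely
-λf is continuous on a compact segment, hence bounded and square-integrable. -/
theorem exists_hasSecondDeriv_iff {f : Γ.Fun} {e : E} {lam : ℂ} :
    (∃ h, Γ.HasSecondDeriv f e h ∧
      ∀ᵐ x ∂(volume.restrict (Set.Icc 0 (Γ.len e))), - h x = lam * Γ.restrict f e x) ↔
    IsSegmentSolution (Γ.len e) lam (Γ.restrict f e) := by
  constructor
  · rintro ⟨h, ⟨h1, -, h3⟩, h4⟩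
    refine ⟨h1, fun x hx => ?_⟩
    have h5 : ∫ t in (0 : ℝ)..x, h t = ∫ t in (0 : ℝ)..x, - (lam * Γ.restrict f e t) := by
      refine intervalIntegral.integral_congr_ae ?_
      have h6 := (ae_restrict_iff' measurableSet_Icc).mp h4
      filter_upwards [h6] with t ht htx
      rw [← ht, neg_neg]
      rw [Set.uIoc_of_le hx.1] at htx
      exact ⟨htx.1.le, htx.2.trans hx.2⟩
    have h7 := h3 x hx
    rw [h5, intervalIntegral.integral_neg, intervalIntegral.integral_const_mul] at h7
    rw [sub_eq_add_neg]
    exact h7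
  · rintro ⟨h1, h2⟩
    refine ⟨fun t => - (lam * Γ.restrict f e t), ⟨h1, ?_, fun x hx => ?_⟩, ?_⟩
    · have hc : ContinuousOn (fun t => - (lam * Γ.restrict f e t)) (Set.Icc 0 (Γ.len e)) :=
        (continuousOn_const.mul h1.continuousOn).neg
      obtain ⟨C, hC⟩ := isCompact_Icc.exists_bound_of_continuousOn hc
      refine MemLp.of_bound (hc.aestronglyMeasurable measurableSet_Icc) C ?_
      exact (ae_restrict_iff' measurableSet_Icc).mpr (Filter.Eventually.of_forall hC)
    · rw [intervalIntegral.integral_neg, intervalIntegral.integral_const_mul, ← sub_eq_add_neg]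
      exact h2 x hx
    · exact Filter.Eventually.of_forall fun x => neg_neg _

/-! ### Functions in directed coordinates -/

/-- The vertex from which the edge `e` starts if it is given the direction `o e`. -/
def start (Γ : QuantumGraph V E) (o : E → Bool) (e : E) : V := if o e then Γ.tgt e else Γ.src e

/-- The function `f` on the edge `e`, as a function of the distance from the start of `e`. -/
def along (o : E → Bool) (f : Γ.Fun) (e : E) (t : ℝ) : ℂ :=
  Γ.restrict f e (Γ.directed (o e) e t)

theorem directed_directed (r : Bool) (e : E) (t : ℝ) :
    Γ.directed r e (Γ.directed r e t) = t := by
  cases r <;> simp [directed]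

theorem directed_mem_Icc (r : Bool) {e : E} {t : ℝ} (ht : t ∈ Set.Icc 0 (Γ.len e)) :
    Γ.directed r e t ∈ Set.Icc 0 (Γ.len e) := by
  cases r
  · exact ht
  · exact ⟨sub_nonneg.mpr ht.2, sub_le_self _ ht.1⟩

theorem isSegmentSolution_along {o : E → Bool} {f : Γ.Fun} {e : E} {lam : ℂ} :
    IsSegmentSolution (Γ.len e) lam (along o f e) ↔
      IsSegmentSolution (Γ.len e) lam (Γ.restrict f e) := by
  have h1 : along o f e = fun t => Γ.restrict f e (Γ.directed (o e) e t) := rfl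
  cases h : o e
  · simp [h1, h, directed]
  · simp only [h1, h, directed, if_true]
    exact ⟨fun h => by simpa using h.reverse, fun h => h.reverse⟩

theorem along_ext {o : E → Bool} {f g : Γ.Fun}
    (h : ∀ e, ∀ t ∈ Set.Icc 0 (Γ.len e), along o f e t = along o g e t) : f = g := by
  funext e ⟨s, hs⟩
  have := h e _ (directed_mem_Icc (o e) hs)
  rw [along, along, directed_directed] at this
  simpa [restrict, Set.IccExtend_of_mem _ _ hs] using this

/-- The values of `f` at the start (`false`) and at the end (`true`) of the edge `e`. -/
def endValue (o : E → Bool) (f : Γ.Fun) (b : Bool) (e : E) : ℂ :=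
  along o f e (if b then Γ.len e else 0)

/-- The outgoing derivatives of `f` at the start (`false`) and at the end (`true`) of the
edge `e`. -/
def endDeriv (o : E → Bool) (f : Γ.Fun) (b : Bool) (e : E) : ℂ :=
  (if b then -1 else 1) *
    derivWithin (along o f e) (Set.Icc 0 (Γ.len e)) (if b then Γ.len e else 0)

open Classical in
/-- The values of `x` at the vertex `v`, where `x false` and `x true` are families of numbers
attached to the starts and to the ends of the edges. -/
def atVertex (Γ : QuantumGraph V E) (o : E → Bool) (v : V) (x : Bool → E → ℂ) (e : E) : ℂ :=
  if Γ.start o e = v then x false e else x true e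

theorem VertexCondition.congr [Finite E] {v : V} {x y x' y' : E → ℂ}
    (hx : ∀ e, Γ.src e = v ∨ Γ.tgt e = v → x e = x' e)
    (hy : ∀ e, Γ.src e = v ∨ Γ.tgt e = v → y e = y' e) :
    Γ.VertexCondition v x y ↔ Γ.VertexCondition v x' y' := by
  unfold VertexCondition
  rw [funext fun e : Γ.Incident v => hx e e.2, funext fun e : Γ.Incident v => hy e e.2]

/-- All vertex conditions of `Γ`, in terms of the values `x` and the outgoing derivatives `y` at
the starts and at the ends of the edges. -/
def EndCondition (Γ : QuantumGraph V E) [Finite E] (o : E → Bool) (x y : Bool → E → ℂ) : Prop :=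
  ∀ v, Γ.VertexCondition v (Γ.atVertex o v x) (Γ.atVertex o v y)

/-- Without loops exactly one end of an incident edge lies at v, so testing `src` and testing
`start` select the same end. -/
theorem vertexValue_eq {o : E → Bool} {f : Γ.Fun} {v : V} {e : E}
    (he : Γ.src e = v ∨ Γ.tgt e = v) :
    Γ.vertexValue f v e = Γ.atVertex o v (endValue o f) e := by
  have := Γ.src_ne_tgt e
  cases h : o e <;> rcases he with he | he <;> subst he <;>
    simp [vertexValue, atVertex, endValue, along, start, h, directed, this, this.symm]

theorem outDeriv_eq {o : E → Bool} {f : Γ.Fun} {v : V} {e : E}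
    (he : Γ.src e = v ∨ Γ.tgt e = v) :
    Γ.outDeriv f v e = Γ.atVertex o v (endDeriv o f) e := by
  have := Γ.src_ne_tgt e
  have h1 : along o f e = fun t => Γ.restrict f e (Γ.directed (o e) e t) := rfl
  cases h : o e <;> rcases he with he | he <;> subst he <;>
    simp [outDeriv, edgeDeriv, atVertex, endDeriv, h1, start, h, directed, this, this.symm,
      IsSegmentSolution.derivWithin_reverse]

theorem mem_eigenspace_iff [Finite E] (o : E → Bool) {f : Γ.Fun} {lam : ℂ} :
    f ∈ Γ.eigenspace lam ↔ (∀ e, IsSegmentSolution (Γ.len e) lam (along o f e)) ∧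
      Γ.EndCondition o (endValue o f) (endDeriv o f) := by
  have h : f ∈ Γ.eigenspace lam ↔ (∀ e, ∃ h, Γ.HasSecondDeriv f e h ∧
      ∀ᵐ x ∂(volume.restrict (Set.Icc 0 (Γ.len e))), - h x = lam * Γ.restrict f e x) ∧
    ∀ v, Γ.VertexCondition v (Γ.vertexValue f v) (Γ.outDeriv f v) := Iff.rfl
  rw [h]
  refine and_congr (forall_congr' fun e => ?_) (forall_congr' fun v => ?_)
  · rw [exists_hasSecondDeriv_iff, isSegmentSolution_along]
  · exact VertexCondition.congr (fun e he => vertexValue_eq he) (fun e he => outDeriv_eq he)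

end QuantumGraph

end

noncomputable section

namespace QuantumGraph

/-! ### Transplantations from linear maps between edge spaces -/

section transplant

variable {V₁ E₁ V₂ E₂ : Type*}
  {Γ₁ : QuantumGraph V₁ E₁} {Γ₂ : QuantumGraph V₂ E₂}

open Classical in
/-- The matrix entries of a linear map between the spaces of functions on two sets of edges. -/
def entry (L : (E₁ → ℂ) →ₗ[ℂ] (E₂ → ℂ)) (e₂ : E₂) (e₁ : E₁) : ℂ := L (Pi.single e₁ 1) e₂

theorem sum_entry [Fintype E₁] (L : (E₁ → ℂ) →ₗ[ℂ] (E₂ → ℂ)) (x : E₁ → ℂ) (e₂ : E₂) :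
    ∑ e₁, entry L e₂ e₁ * x e₁ = L x e₂ := by
  classical
  rw [LinearMap.pi_apply_eq_sum_univ L x, Finset.sum_apply]
  refine Finset.sum_congr rfl fun e₁ _ => ?_
  rw [Pi.smul_apply, smul_eq_mul, mul_comm, entry]
  refine congrArg (fun y => x e₁ * L y e₂) ?_
  funext j
  rw [Pi.single_apply]
  simp only [eq_comm]

/-- The linear map `L` intertwines the multiplications by the lengths of the edges. -/
def CommutesWithLength (Γ₁ : QuantumGraph V₁ E₁) (Γ₂ : QuantumGraph V₂ E₂)
    (L : (E₁ → ℂ) →ₗ[ℂ] (E₂ → ℂ)) : Prop :=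
  ∀ x : E₁ → ℂ, L (fun e => (Γ₁.len e : ℂ) * x e) = fun e => (Γ₂.len e : ℂ) * L x e

/-- Applying the commutation to the indicator function of e₁ multiplies the same matrix entry by the
two lengths; a non-zero entry cancels. -/
theorem CommutesWithLength.len_eq {L : (E₁ → ℂ) →ₗ[ℂ] (E₂ → ℂ)}
    (hL : CommutesWithLength Γ₁ Γ₂ L) {e₁ : E₁} {e₂ : E₂} (h : entry L e₂ e₁ ≠ 0) :
    Γ₁.len e₁ = Γ₂.len e₂ := by
  classical
  have h1 : (fun e => (Γ₁.len e : ℂ) * (Pi.single e₁ (1 : ℂ) : E₁ → ℂ) e) =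
      (Γ₁.len e₁ : ℂ) • (Pi.single e₁ 1 : E₁ → ℂ) := by
    funext e
    by_cases he : e = e₁
    · subst he; rfl
    · simp [he]
  have h2 := congrFun (hL (Pi.single e₁ 1)) e₂
  rw [h1, map_smul, Pi.smul_apply, smul_eq_mul] at h2
  have h3 : L (Pi.single e₁ 1) e₂ ≠ 0 := by
    unfold entry at h
    convert h
  exact_mod_cast mul_right_cancel₀ h3 h2

variable [Fintype E₁]

/-- The map on functions which combines the restrictions to the edges with the coefficients
of `L`. -/
def transplant (Γ₁ : QuantumGraph V₁ E₁) (Γ₂ : QuantumGraph V₂ E₂) (o₁ : E₁ → Bool)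
    (o₂ : E₂ → Bool) (L : (E₁ → ℂ) →ₗ[ℂ] (E₂ → ℂ)) : Γ₁.Fun →ₗ[ℂ] Γ₂.Fun where
  toFun f e₂ t := ∑ e₁, entry L e₂ e₁ * along o₁ f e₁ (Γ₂.directed (o₂ e₂) e₂ t)
  map_add' f g := by
    funext e₂ t
    simp only [along, restrict_add, Pi.add_apply, mul_add, Finset.sum_add_distrib]
  map_smul' c f := by
    funext e₂ t
    simp only [along, restrict_smul, Pi.smul_apply, smul_eq_mul, Finset.mul_sum, RingHom.id_apply]
    exact Finset.sum_congr rfl fun e₁ _ => mul_left_comm _ _ _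

variable {o₁ : E₁ → Bool} {o₂ : E₂ → Bool} {L : (E₁ → ℂ) →ₗ[ℂ] (E₂ → ℂ)}

theorem along_transplant (f : Γ₁.Fun) {e₂ : E₂} {t : ℝ} (ht : t ∈ Set.Icc 0 (Γ₂.len e₂)) :
    along o₂ (transplant Γ₁ Γ₂ o₁ o₂ L f) e₂ t = ∑ e₁, entry L e₂ e₁ * along o₁ f e₁ t := by
  rw [along, restrict, Set.IccExtend_of_mem _ _ (directed_mem_Icc _ ht)]
  simp only [transplant, LinearMap.coe_mk, AddHom.coe_mk, directed_directed]

/-- Edges joined by a non-zero entry have the same length, so their ends, and not only their starts,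
sit at the same parameter. -/
theorem endValue_transplant (hL : CommutesWithLength Γ₁ Γ₂ L) (f : Γ₁.Fun) (b : Bool) :
    endValue o₂ (transplant Γ₁ Γ₂ o₁ o₂ L f) b = L (endValue o₁ f b) := by
  funext e₂
  have hl := (Γ₂.len_pos e₂).le
  rw [endValue, along_transplant f (by cases b <;> simp [hl]), ← sum_entry]
  refine Finset.sum_congr rfl fun e₁ _ => ?_
  by_cases h : entry L e₂ e₁ = 0
  · simp [h]
  · rw [endValue, hL.len_eq h]

theorem endDeriv_transplant (hL : CommutesWithLength Γ₁ Γ₂ L) {f : Γ₁.Fun}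
    (hf : ∀ e, DifferentiableOn ℝ (along o₁ f e) (Set.Icc 0 (Γ₁.len e))) (b : Bool) :
    endDeriv o₂ (transplant Γ₁ Γ₂ o₁ o₂ L f) b = L (endDeriv o₁ f b) := by
  funext e₂
  have hl := (Γ₂.len_pos e₂).le
  have hx : (if b then Γ₂.len e₂ else 0) ∈ Set.Icc 0 (Γ₂.len e₂) := by cases b <;> simp [hl]
  rw [endDeriv, derivWithin_congr (fun t ht => along_transplant f ht)
    (along_transplant f hx), IsSegmentSolution.derivWithin_sum_mul, Finset.mul_sum, ← sum_entry]
  · refine Finset.sum_congr rfl fun e₁ _ => ?_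
    by_cases h : entry L e₂ e₁ = 0
    · simp [h]
    · rw [endDeriv, hL.len_eq h]
      ring
  · intro e₁ h
    have h1 := hf e₁
    rw [hL.len_eq h] at h1
    exact h1 _ hx

theorem transplant_mem_eigenspace [Finite E₂] (hL : CommutesWithLength Γ₁ Γ₂ L)
    (hC : ∀ x y, Γ₁.EndCondition o₁ x y →
      Γ₂.EndCondition o₂ (fun b => L (x b)) (fun b => L (y b)))
    {f : Γ₁.Fun} {lam : ℂ} (hf : f ∈ Γ₁.eigenspace lam) :
    transplant Γ₁ Γ₂ o₁ o₂ L f ∈ Γ₂.eigenspace lam := by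
  rw [mem_eigenspace_iff o₁] at hf
  rw [mem_eigenspace_iff o₂]
  refine ⟨fun e₂ => ?_, ?_⟩
  · refine (IsSegmentSolution.sum_mul (c := entry L e₂) (w := along o₁ f) fun e₁ h => ?_).congr
      fun t ht => along_transplant f ht
    rw [← hL.len_eq h]
    exact hf.1 e₁
  · have h1 : endValue o₂ (transplant Γ₁ Γ₂ o₁ o₂ L f) = fun b => L (endValue o₁ f b) :=
      funext fun b => endValue_transplant hL f b
    have h2 : endDeriv o₂ (transplant Γ₁ Γ₂ o₁ o₂ L f) = fun b => L (endDeriv o₁ f b) :=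
      funext fun b => endDeriv_transplant hL (fun e => (hf.1 e).1) b
    rw [h1, h2]
    exact hC _ _ hf.2

theorem transplant_transplant [Fintype E₂] {L' : (E₂ → ℂ) →ₗ[ℂ] (E₁ → ℂ)}
    (hL' : CommutesWithLength Γ₂ Γ₁ L') (h : ∀ x, L' (L x) = x) (f : Γ₁.Fun) :
    transplant Γ₂ Γ₁ o₂ o₁ L' (transplant Γ₁ Γ₂ o₁ o₂ L f) = f := by
  refine along_ext (o := o₁) fun e t ht => ?_
  rw [along_transplant _ ht]
  have h1 : ∀ e₂, entry L' e e₂ * along o₂ (transplant Γ₁ Γ₂ o₁ o₂ L f) e₂ t =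
      entry L' e e₂ * L (fun e₁ => along o₁ f e₁ t) e₂ := fun e₂ => by
    by_cases h2 : entry L' e e₂ = 0
    · simp [h2]
    -- The non-zero entry makes the lengths equal, so t also lies in the segment of e₂.
    · rw [← hL'.len_eq h2] at ht
      rw [along_transplant f ht, sum_entry L fun e₁ => along o₁ f e₁ t]
  rw [Finset.sum_congr rfl fun e₂ _ => h1 e₂, sum_entry, h]

/-- The hypotheses pass to the inverse of L, whose transplantation inverts that of L. None of this
involves λ. -/
theorem transplantable_of_linearEquiv [Fintype E₂] (o₁ : E₁ → Bool) (o₂ : E₂ → Bool)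
    (L : (E₁ → ℂ) ≃ₗ[ℂ] (E₂ → ℂ)) (hL : CommutesWithLength Γ₁ Γ₂ L)
    (hC : ∀ x y, Γ₁.EndCondition o₁ x y ↔
      Γ₂.EndCondition o₂ (fun b => L (x b)) (fun b => L (y b))) :
    Transplantable Γ₁ Γ₂ := by
  have hL' : CommutesWithLength Γ₂ Γ₁ (L.symm : (E₂ → ℂ) →ₗ[ℂ] (E₁ → ℂ)) := fun x => by
    have h := hL (L.symm x)
    simp only [LinearEquiv.coe_coe, LinearEquiv.apply_symm_apply] at h ⊢
    rw [← h, LinearEquiv.symm_apply_apply]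
  refine ⟨transplant Γ₁ Γ₂ o₁ o₂ L, ⟨o₁, o₂, entry L, fun e₂ e₁ h => hL.len_eq h,
    fun f e₂ t ht => along_transplant f ht⟩, fun lam => ?_⟩
  refine Set.BijOn.mk
    (fun f hf => transplant_mem_eigenspace hL (fun x y h => (hC x y).mp h) hf) ?_ ?_
  · intro f _ g _ hfg
    have h := congrArg (transplant Γ₂ Γ₁ o₂ o₁ (L.symm : (E₂ → ℂ) →ₗ[ℂ] (E₁ → ℂ))) hfg
    rwa [transplant_transplant hL' (by simp), transplant_transplant hL' (by simp)] at h
  · intro f hf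
    refine ⟨transplant Γ₂ Γ₁ o₂ o₁ (L.symm : (E₂ → ℂ) →ₗ[ℂ] (E₁ → ℂ)) f,
      transplant_mem_eigenspace hL' (fun x y h => ?_) hf, transplant_transplant hL (by simp) f⟩
    rw [hC]
    simpa using h

end transplant

end QuantumGraph

end

noncomputable section

namespace Representation

/-! ### Equivariant maps into the functions on a `G`-set -/

section equivariantMaps

variable {H W W' : Type*} [Group H] [AddCommGroup W] [Module ℂ W] [AddCommGroup W'] [Module ℂ W']

/-- The equivariant linear maps from `W` to the complex functions on the `H`-set `E`. -/
def equivariantMaps (ρ : Representation ℂ H W) (E : Type*) [MulAction H E] :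
    Submodule ℂ (W →ₗ[ℂ] E → ℂ) where
  carrier := {φ | ∀ h w e, φ (ρ h w) (h • e) = φ w e}
  add_mem' hφ hψ h w e := by
    rw [LinearMap.add_apply, LinearMap.add_apply, Pi.add_apply, Pi.add_apply, hφ, hψ]
  zero_mem' _ _ _ := rfl
  smul_mem' c φ hφ h w e := by
    rw [LinearMap.smul_apply, LinearMap.smul_apply, Pi.smul_apply, Pi.smul_apply, hφ]

/-- Equivalent representations have the same equivariant maps. -/
def equivariantMapsCongr {ρ : Representation ℂ H W} {σ : Representation ℂ H W'}
    (α : Representation.Equiv ρ σ) (E : Type*) [MulAction H E] :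
    ρ.equivariantMaps E ≃ₗ[ℂ] σ.equivariantMaps E where
  toFun φ := ⟨φ.1 ∘ₗ (α.toLinearEquiv.symm : W' →ₗ[ℂ] W), fun h w e => by
    have h1 : α.toLinearEquiv.symm (σ h w) = ρ h (α.toLinearEquiv.symm w) := by
      rw [LinearEquiv.symm_apply_eq]
      have h2 := α.toIntertwiningMap.isIntertwining ρ σ h (α.toLinearEquiv.symm w)
      have h3 : α.toIntertwiningMap (α.toLinearEquiv.symm w) = w :=
        α.toLinearEquiv.apply_symm_apply w
      rw [h3] at h2
      exact h2.symm
    exact (congrArg (fun w => φ.1 w (h • e)) h1).trans (φ.2 h _ e)⟩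
  invFun ψ := ⟨ψ.1 ∘ₗ (α.toLinearEquiv : W →ₗ[ℂ] W'), fun h w e => by
    have h2 : α.toLinearEquiv (ρ h w) = σ h (α.toLinearEquiv w) :=
      α.toIntertwiningMap.isIntertwining ρ σ h w
    exact (congrArg (fun w => ψ.1 w (h • e)) h2).trans (ψ.2 h _ e)⟩
  map_add' _ _ := rfl
  map_smul' _ _ := rfl
  left_inv φ := Subtype.ext <| LinearMap.ext fun w =>
    congrArg φ.1 (α.toLinearEquiv.symm_apply_apply w)
  right_inv ψ := Subtype.ext <| LinearMap.ext fun w =>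
    congrArg ψ.1 (α.toLinearEquiv.apply_symm_apply w)

theorem equivariantMapsCongr_apply {ρ : Representation ℂ H W} {σ : Representation ℂ H W'}
    (α : Representation.Equiv ρ σ) {E : Type*} [MulAction H E] (φ : ρ.equivariantMaps E) (w : W) :
    (equivariantMapsCongr α E φ).1 (α.toLinearEquiv w) = φ.1 w :=
  congrArg φ.1 (α.toLinearEquiv.symm_apply_apply w)

/-! ### Frobenius reciprocity for maps into functions on a G-set -/

variable {G : Type*} [Group G] {K : Subgroup G} (σ : Representation ℂ K W) (E : Type*)
  [MulAction G E]

variable {σ} in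
theorem IndV.hom_ext_apply {X : Type*} {L₁ L₂ : IndV K.subtype σ →ₗ[ℂ] X → ℂ}
    (h : ∀ g w e, L₁ (IndV.mk K.subtype σ g w) e = L₂ (IndV.mk K.subtype σ g w) e) : L₁ = L₂ :=
  IndV.hom_ext _ _ fun g => LinearMap.ext fun w => funext (h g w)

/-- The extension of an equivariant map to the induced representation. -/
def indLift (φ : σ.equivariantMaps E) : IndV K.subtype σ →ₗ[ℂ] E → ℂ :=
  Coinvariants.lift _ (TensorProduct.lift
    ((Finsupp.lift _ ℂ G fun g => LinearMap.funLeft ℂ ℂ (fun e : E => g • e) ∘ₗ φ.1) ∘ₗ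
      (MonoidAlgebra.coeffLinearEquiv ℂ).toLinearMap)) fun k => by
    ext g w e
    -- The lift sends g ⊗ w to e ↦ φ(w)(ge); K-equivariance of φ is exactly invariance under (g, w)
    -- ↦ (kg, σ(k)w).
    have h := φ.2 k w (g • e)
    rw [Subgroup.smul_def, ← mul_smul] at h
    simpa [LinearMap.funLeft_apply] using h

variable {σ E}

theorem indLift_mk (φ : σ.equivariantMaps E) (g : G) (w : W) (e : E) :
    indLift σ E φ (IndV.mk K.subtype σ g w) e = φ.1 w (g • e) := by
  simp [indLift, LinearMap.funLeft_apply]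

theorem indLift_mem (φ : σ.equivariantMaps E) :
    indLift σ E φ ∈ (σ.ind K.subtype).equivariantMaps E := by
  intro g z e
  have h : LinearMap.funLeft ℂ ℂ (fun e : E => g • e) ∘ₗ (indLift σ E φ ∘ₗ σ.ind K.subtype g) =
      indLift σ E φ := by
    refine IndV.hom_ext_apply fun g' w e => ?_
    have h1 : indLift σ E φ (σ.ind K.subtype g (IndV.mk K.subtype σ g' w)) (g • e) =
        φ.1 w (g' • e) := by
      rw [ind_mk, indLift_mk, mul_smul, inv_smul_smul]
    exact h1.trans (indLift_mk φ g' w e).symm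
  exact congrFun (LinearMap.congr_fun h z) e

variable (σ E)

/-- Frobenius reciprocity for equivariant maps into the functions on a `G`-set. -/
def frobeniusEquiv : σ.equivariantMaps E ≃ₗ[ℂ] (σ.ind K.subtype).equivariantMaps E where
  toFun φ := ⟨indLift σ E φ, indLift_mem φ⟩
  invFun ψ := ⟨ψ.1 ∘ₗ IndV.mk K.subtype σ 1, fun k w e => by
    have h := ψ.2 (k : G) (IndV.mk K.subtype σ 1 w) e
    -- In the coinvariants k may be moved from w to the group factor, where it becomes the right
    -- translation by which k acts on the induced representation.
    have h2 : IndV.mk K.subtype σ 1 (σ k w) = IndV.mk K.subtype σ (k : G)⁻¹ w := by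
      simp [← Coinvariants.mk_inv_tmul]
    rw [ind_mk, one_mul, ← h2] at h
    exact h⟩
  map_add' φ ψ := Subtype.ext <| IndV.hom_ext_apply fun g w e =>
    (indLift_mk _ g w e).trans
      (congrArg₂ (· + ·) (indLift_mk φ g w e) (indLift_mk ψ g w e)).symm
  map_smul' c φ := Subtype.ext <| IndV.hom_ext_apply fun g w e =>
    (indLift_mk _ g w e).trans (congrArg (c • ·) (indLift_mk φ g w e)).symm
  left_inv φ := Subtype.ext <| LinearMap.ext fun w => funext fun e =>
    (indLift_mk φ 1 w e).trans (by rw [one_smul])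
  right_inv ψ := Subtype.ext <| IndV.hom_ext_apply fun g w e => by
    -- The class of g ⊗ w is moved by g to that of 1 ⊗ w, so ψ is determined on the latter.
    have h := ψ.2 g (IndV.mk K.subtype σ g w) e
    rw [ind_mk, mul_inv_cancel] at h
    exact (indLift_mk _ g w e).trans h

variable {σ E}

theorem frobeniusEquiv_mk (φ : σ.equivariantMaps E) (g : G) (w : W) (e : E) :
    (frobeniusEquiv σ E φ).1 (IndV.mk K.subtype σ g w) e = φ.1 w (g • e) :=
  indLift_mk φ g w e

theorem eq_top_of_mk_mem {S : Submodule ℂ (IndV K.subtype σ)}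
    (h : ∀ g w, IndV.mk K.subtype σ g w ∈ S) : S = ⊤ := by
  have h1 : S.mkQ = 0 := IndV.hom_ext _ _ fun g => LinearMap.ext fun w => by
    rw [LinearMap.comp_apply, Submodule.mkQ_apply, (Submodule.Quotient.mk_eq_zero S).mpr (h g w)]
    rfl
  rw [← S.ker_mkQ, h1, LinearMap.ker_zero]

end equivariantMaps

/-! ### The averaging projection -/

section average

variable {K W : Type*} [Group K] [Fintype K] [AddCommGroup W] [Module ℂ W]
  [Invertible (Fintype.card K : ℂ)] (σ : Representation ℂ K W)

theorem averageMap_eq (w : W) : σ.averageMap w = (⅟(Fintype.card K : ℂ)) • ∑ g, σ g w := by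
  simp [averageMap, GroupAlgebra.average, map_sum, LinearMap.sum_apply]

theorem averageMap_apply_apply (g : K) (w : W) : σ.averageMap (σ g w) = σ.averageMap w := by
  rw [averageMap_eq, averageMap_eq]
  congr 1
  refine Fintype.sum_equiv (Equiv.mulRight g) _ _ fun k => ?_
  simp

/-- The invariants of an irreducible subrepresentation are zero or everything, and everything would
make it trivial. Averages are invariant, hence zero. -/
theorem averageMap_eq_zero_of_mem_nontrivialPart {w : W} (hw : w ∈ σ.nontrivialPart) :
    σ.averageMap w = 0 := by
  suffices h : σ.nontrivialPart ≤ LinearMap.ker σ.averageMap from h hw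
  refine iSup₂_le fun S hS v hv => ?_
  obtain ⟨h1, h2⟩ := hS
  rw [LinearMap.mem_ker]
  set τ := S.toRepresentation
  let F : Subrepresentation τ := ⟨τ.invariants, fun g x hx => by rwa [hx g]⟩
  have h3 : ((τ.averageMap ⟨v, hv⟩ : S.toSubmodule) : W) = σ.averageMap v := by
    rw [averageMap_eq, averageMap_eq]
    simp only [Submodule.coe_smul, Submodule.coe_sum]
    rfl
  rcases h1.eq_bot_or_eq_top F with hF | hF
  · have h4 : τ.averageMap ⟨v, hv⟩ ∈ F.toSubmodule := τ.averageMap_invariant _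
    rw [hF] at h4
    rw [← h3, (Submodule.mem_bot ℂ).mp h4]
    rfl
  · refine absurd ⟨fun g => LinearMap.ext fun x => ?_⟩ h2
    have h4 : x ∈ F.toSubmodule := by
      rw [hF]
      exact Submodule.mem_top
    exact h4 g

end average

end Representation

end

noncomputable section

namespace QuantumGraph

namespace QuotientChoice

/-! ### Functions on the edges of the quotient as equivariant maps -/

variable {V E : Type*} {Γ : QuantumGraph V E} {H W : Type*} [Group H] [MulAction H V]
  [MulAction H E] [AddCommGroup W] [Module ℂ W] {ρ : Representation ℂ H W}
  (c : Γ.QuotientChoice ρ)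

theorem mk_eq_of_smul_edgeRep {i : MulAction.orbitRel.Quotient H E} {g : H} {e : E}
    (h : g • c.edgeRep i = e) : (Quotient.mk'' e : MulAction.orbitRel.Quotient H E) = i := by
  rw [← c.mk_edgeRep i, ← h]
  exact Quotient.sound ⟨g, rfl⟩

theorem exists_smul_edgeRep (e : E) : ∃ g : H, g • c.edgeRep (Quotient.mk'' e) = e :=
  Quotient.exact (c.mk_edgeRep (Quotient.mk'' e)).symm

/-- A group element which carries the representative of the orbit of `e` to `e`. -/
def mover (e : E) : H := (c.exists_smul_edgeRep e).choose

theorem mover_smul (e : E) : c.mover e • c.edgeRep (Quotient.mk'' e) = e :=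
  (c.exists_smul_edgeRep e).choose_spec

variable [FiniteDimensional ℂ W]

theorem copies_le (i : MulAction.orbitRel.Quotient H E) : c.copies i ≤ Module.finrank ℂ W :=
  Submodule.finrank_le _

/-- The vector `b^i_j` of the basis `B^i`, for `j ≤ d_i`. -/
def fixedVector (i : MulAction.orbitRel.Quotient H E) (j : Fin (c.copies i)) : W :=
  c.edgeBasis i (Fin.castLE (c.copies_le i) j)

/-- The coordinate with respect to the vector `b^i_j` of the basis `B^i`, for `j ≤ d_i`. -/
def fixedCoord (i : MulAction.orbitRel.Quotient H E) (j : Fin (c.copies i)) : W →ₗ[ℂ] ℂ :=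
  (c.edgeBasis i).coord (Fin.castLE (c.copies_le i) j)

open Classical in
theorem fixedCoord_fixedVector (i : MulAction.orbitRel.Quotient H E) (j j' : Fin (c.copies i)) :
    c.fixedCoord i j (c.fixedVector i j') = if j' = j then 1 else 0 := by
  simp [fixedCoord, fixedVector, Finsupp.single_apply, Fin.ext_iff]

section average

variable [Finite H]

instance (e : E) : Fintype (MulAction.stabilizer H e) := Fintype.ofFinite _

instance (e : E) : Invertible (Fintype.card (MulAction.stabilizer H e) : ℂ) :=
  invertibleOfNonzero (Nat.cast_ne_zero.mpr Fintype.card_ne_zero)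

omit [FiniteDimensional ℂ W] in
theorem averageMap_edgeBasis_of_lt {i : MulAction.orbitRel.Quotient H E}
    {j : Fin (Module.finrank ℂ W)} (h : (j : ℕ) < c.copies i) :
    (ρ.resStabilizer (c.edgeRep i)).averageMap (c.edgeBasis i j) = c.edgeBasis i j :=
  Representation.averageMap_id _ _ (c.edgeBasis_mem_invariants i j h)

omit [FiniteDimensional ℂ W] in
theorem averageMap_edgeBasis_of_le {i : MulAction.orbitRel.Quotient H E}
    {j : Fin (Module.finrank ℂ W)} (h : c.copies i ≤ (j : ℕ)) :
    (ρ.resStabilizer (c.edgeRep i)).averageMap (c.edgeBasis i j) = 0 :=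
  Representation.averageMap_eq_zero_of_mem_nontrivialPart _
    (c.edgeBasis_mem_nontrivialPart i j h)

/-- Averaging fixes the first d_i vectors of B^i and kills the others, so it does not change the
first d_i coordinates. -/
theorem fixedCoord_averageMap (i : MulAction.orbitRel.Quotient H E) (j : Fin (c.copies i))
    (w : W) :
    c.fixedCoord i j ((ρ.resStabilizer (c.edgeRep i)).averageMap w) = c.fixedCoord i j w := by
  have h : c.fixedCoord i j ∘ₗ (ρ.resStabilizer (c.edgeRep i)).averageMap = c.fixedCoord i j := by
    refine (c.edgeBasis i).ext fun j' => ?_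
    rw [LinearMap.comp_apply]
    rcases lt_or_ge (j' : ℕ) (c.copies i) with h | h
    · rw [c.averageMap_edgeBasis_of_lt h]
    · have h1 : j' ≠ Fin.castLE (c.copies_le i) j := fun h2 => by
        have := j.2
        rw [h2, Fin.val_castLE] at h
        omega
      rw [c.averageMap_edgeBasis_of_le h, map_zero, fixedCoord, Module.Basis.coord_apply,
        Module.Basis.repr_self, Finsupp.single_eq_of_ne h1.symm]
  exact LinearMap.congr_fun h w

/-- The elements g and h differ by an element of the stabilizer, which the average absorbs. Hence
`extend` does not depend on the choice of `mover`, and the arbitrary `transporter` may replace it.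
-/
theorem fixedCoord_of_smul_eq {i : MulAction.orbitRel.Quotient H E} (j : Fin (c.copies i))
    {g h : H} (hgh : g • c.edgeRep i = h • c.edgeRep i) (w : W) :
    c.fixedCoord i j (ρ g⁻¹ w) = c.fixedCoord i j (ρ h⁻¹ w) := by
  have hs : g⁻¹ * h ∈ MulAction.stabilizer H (c.edgeRep i) := by
    rw [MulAction.mem_stabilizer_iff, mul_smul, ← hgh, inv_smul_smul]
  have h1 : ρ g⁻¹ w = ρ.resStabilizer (c.edgeRep i) ⟨g⁻¹ * h, hs⟩ (ρ h⁻¹ w) := by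
    change _ = ρ (g⁻¹ * h) (ρ h⁻¹ w)
    rw [← Module.End.mul_apply, ← map_mul, mul_inv_cancel_right]
  rw [h1, ← fixedCoord_averageMap, Representation.averageMap_apply_apply, fixedCoord_averageMap]

end average

/-- The map from `W` to the functions on the edges of `Γ` which corresponds to a function `x` on
the edges of the quotient. -/
def extend (x : c.Edge → ℂ) : W →ₗ[ℂ] E → ℂ :=
  LinearMap.pi fun e => ∑ j, x ⟨Quotient.mk'' e, j⟩ • (c.fixedCoord (Quotient.mk'' e) j ∘ₗ
    ρ (c.mover e)⁻¹)

theorem extend_apply (x : c.Edge → ℂ) (w : W) (e : E) :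
    c.extend x w e = ∑ j, x ⟨Quotient.mk'' e, j⟩ *
      c.fixedCoord (Quotient.mk'' e) j (ρ (c.mover e)⁻¹ w) := by
  simp [extend, LinearMap.sum_apply]

variable [Finite H]

theorem extend_of_smul_eq (x : c.Edge → ℂ) (w : W) {i : MulAction.orbitRel.Quotient H E} {g : H}
    {e : E} (h : g • c.edgeRep i = e) :
    c.extend x w e = ∑ j, x ⟨i, j⟩ * c.fixedCoord i j (ρ g⁻¹ w) := by
  obtain rfl := c.mk_eq_of_smul_edgeRep h
  rw [extend_apply]
  refine Finset.sum_congr rfl fun j _ => ?_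
  rw [c.fixedCoord_of_smul_eq j (h.trans (c.mover_smul e).symm)]

theorem extend_mem (x : c.Edge → ℂ) : c.extend x ∈ ρ.equivariantMaps E := by
  intro h w e
  rw [c.extend_of_smul_eq x w (c.mover_smul e),
    -- Use h · `mover e`, rather than the `mover` chosen for h • e, to reach the latter.
    c.extend_of_smul_eq x (ρ h w) (i := Quotient.mk'' e) (g := h * c.mover e)
      (by rw [mul_smul, mover_smul])]
  refine Finset.sum_congr rfl fun j _ => ?_
  rw [mul_inv_rev, map_mul, Module.End.mul_apply, Representation.inv_self_apply]

-- By equivariance, w ↦ φ(w)(ẽ^i) is constant on orbits of the stabilizer of ẽ^i, so it factors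
-- through the average.
omit [FiniteDimensional ℂ W] in
theorem equivariant_edgeRep_eq_zero {φ : W →ₗ[ℂ] E → ℂ} (hφ : φ ∈ ρ.equivariantMaps E)
    {i : MulAction.orbitRel.Quotient H E} {w : W}
    (hw : (ρ.resStabilizer (c.edgeRep i)).averageMap w = 0) : φ w (c.edgeRep i) = 0 := by
  have h1 : ∀ g : MulAction.stabilizer H (c.edgeRep i),
      φ (ρ.resStabilizer (c.edgeRep i) g w) (c.edgeRep i) = φ w (c.edgeRep i) := fun g => by
    have h := hφ (g : H) w (c.edgeRep i)
    rwa [MulAction.mem_stabilizer_iff.mp g.2] at h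
  have h2 := congrFun (congrArg φ hw) (c.edgeRep i)
  rw [Representation.averageMap_eq, map_smul, map_sum, Pi.smul_apply, Finset.sum_apply,
    Finset.sum_congr rfl fun g _ => h1 g, Finset.sum_const, Finset.card_univ, nsmul_eq_mul,
    smul_eq_mul, invOf_mul_cancel_left', map_zero] at h2
  exact h2

theorem equivariant_edgeRep {φ : W →ₗ[ℂ] E → ℂ} (hφ : φ ∈ ρ.equivariantMaps E)
    (i : MulAction.orbitRel.Quotient H E) (w : W) :
    φ w (c.edgeRep i) = ∑ j, φ (c.fixedVector i j) (c.edgeRep i) * c.fixedCoord i j w := by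
  have h1 : φ w (c.edgeRep i) = ∑ j, φ (c.edgeBasis i j) (c.edgeRep i) * (c.edgeBasis i).repr w j := by
    conv_lhs => rw [← (c.edgeBasis i).sum_repr w]
    rw [map_sum, Finset.sum_apply]
    refine Finset.sum_congr rfl fun j _ => ?_
    rw [map_smul, Pi.smul_apply, smul_eq_mul, mul_comm]
  rw [h1]
  symm
  refine Fintype.sum_of_injective (Fin.castLE (c.copies_le i)) (Fin.castLE_injective _) _ _
    (fun j hj => ?_) fun j => rfl
  have h2 : c.copies i ≤ (j : ℕ) := by
    by_contra h
    exact hj ⟨⟨j, not_le.mp h⟩, rfl⟩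
  rw [c.equivariant_edgeRep_eq_zero hφ (c.averageMap_edgeBasis_of_le h2), zero_mul]

/-- The functions on the edges of the quotient correspond to the equivariant maps from `W` to the
functions on the edges of `Γ`. -/
def edgeEquiv : (c.Edge → ℂ) ≃ₗ[ℂ] ρ.equivariantMaps E where
  toFun x := ⟨c.extend x, c.extend_mem x⟩
  invFun φ e := φ.1 (c.fixedVector e.1 e.2) (c.edgeRep e.1)
  map_add' x y := by
    ext w e
    simp only [extend_apply, Submodule.coe_add, LinearMap.add_apply, Pi.add_apply, add_mul,
      Finset.sum_add_distrib]
  map_smul' a x := by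
    ext w e
    simp only [extend_apply, Submodule.coe_smul, LinearMap.smul_apply, Pi.smul_apply, smul_eq_mul,
      mul_assoc, Finset.mul_sum, RingHom.id_apply]
  left_inv x := by
    classical
    funext ⟨i, j⟩
    change c.extend x (c.fixedVector i j) (c.edgeRep i) = x ⟨i, j⟩
    rw [c.extend_of_smul_eq x _ (one_smul H (c.edgeRep i))]
    simp [fixedCoord_fixedVector]
  right_inv φ := by
    refine Subtype.ext (LinearMap.ext fun w => funext fun e => ?_)
    change c.extend _ w e = φ.1 w e
    rw [c.extend_of_smul_eq _ w (c.mover_smul e)]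
    have h := φ.2 (c.mover e) (ρ (c.mover e)⁻¹ w) (c.edgeRep (Quotient.mk'' e))
    rw [mover_smul, Representation.self_inv_apply] at h
    rw [h, c.equivariant_edgeRep φ.2]

end QuotientChoice

end QuantumGraph

end

noncomputable section

namespace QuantumGraph

/-! ### Symmetric directions -/

section symmetry

variable {V E : Type*} {Γ : QuantumGraph V E} [Finite E] {G : Type*} [Group G] [MulAction G V]
  [MulAction G E]

theorem IsSymmetry.src_smul_or (hΓ : Γ.IsSymmetry G) (g : G) (e : E) :
    Γ.src (g • e) = g • Γ.src e ∧ Γ.tgt (g • e) = g • Γ.tgt e ∨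
      Γ.src (g • e) = g • Γ.tgt e ∧ Γ.tgt (g • e) = g • Γ.src e := by
  have h := hΓ.ends_smul g e
  rwa [Sym2.eq_iff] at h

/-- An element fixing an edge cannot flip it, for it would carry one end to the neighbouring one. -/
theorem IsSymmetry.smul_src_of_smul_eq (hΓ : Γ.IsSymmetry G) {g : G} {e : E} (h : g • e = e) :
    g • Γ.src e = Γ.src e := by
  rcases hΓ.src_smul_or g e with ⟨h1, -⟩ | ⟨-, h2⟩
  · rw [← h1, h]
  · rw [h] at h2
    exact absurd h2.symm (hΓ.smul_src_ne_tgt g e)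

/-- Direct one representative of each orbit and transport the direction; this is consistent because
edge stabilizers fix both ends. -/
theorem IsSymmetry.exists_start_smul (hΓ : Γ.IsSymmetry G) :
    ∃ o : E → Bool, ∀ (g : G) (e : E), Γ.start o (g • e) = g • Γ.start o e := by
  classical
  let r : E → E := fun e =>
    Quotient.out (Quotient.mk'' e : MulAction.orbitRel.Quotient G E)
  have hr : ∀ e, ∃ g : G, g • r e = e := fun e => Quotient.exact
    (show (Quotient.mk'' e : MulAction.orbitRel.Quotient G E) = Quotient.mk'' (r e) from
      (Quotient.out_eq' _).symm)
  choose m hm using hr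
  let o : E → Bool := fun e => decide (Γ.src e ≠ m e • Γ.src (r e))
  have ho : ∀ e, Γ.start o e = m e • Γ.src (r e) := fun e => by
    by_cases h : Γ.src e = m e • Γ.src (r e)
    · simp [start, o, h]
    · have h1 := hΓ.src_smul_or (m e) (r e)
      rw [hm] at h1
      simp [start, o, h, (h1.resolve_left fun h2 => h h2.1).2]
  refine ⟨o, fun g e => ?_⟩
  have h1 : r (g • e) = r e := congrArg Quotient.out (Quotient.sound ⟨g, rfl⟩)
  -- The two ways of carrying r e to g • e differ by this element of its stabilizer, which fixes the
  -- source of r e.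
  have h2 : (m (g • e))⁻¹ • g • m e • r e = r e := by
    rw [hm, inv_smul_eq_iff, ← h1, hm]
  rw [smul_smul, smul_smul] at h2
  have h3 := hΓ.smul_src_of_smul_eq h2
  rw [← smul_smul, ← smul_smul, inv_smul_eq_iff] at h3
  rw [ho, ho, h1, h3]

variable {o : E → Bool}

omit [Finite E] in
theorem start_eq_or (o : E → Bool) (e : E) :
    Γ.start o e = Γ.src e ∨ Γ.start o e = Γ.tgt e := by
  unfold start
  split_ifs <;> simp

/-- Otherwise v would be the other end of e, and g would carry the start to its neighbour. Thus the
vertex orbit of a start already tells which end of an incident edge is meant. -/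
theorem IsSymmetry.start_eq_of_smul_eq (hΓ : Γ.IsSymmetry G) {e : E} {v : V}
    (he : Γ.src e = v ∨ Γ.tgt e = v) {g : G} (h : g • Γ.start o e = v) : Γ.start o e = v := by
  rcases start_eq_or (Γ := Γ) o e with h1 | h1 <;> rcases he with h2 | h2
  · rw [h1, h2]
  · rw [h1, ← h2] at h
    exact absurd h (hΓ.smul_src_ne_tgt g e)
  · rw [h1, ← h2, smul_eq_iff_eq_inv_smul] at h
    exact absurd h.symm (hΓ.smul_src_ne_tgt g⁻¹ e)
  · rw [h1, h2]

omit [Finite E] in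
theorem atVertex_smul (ho : ∀ (g : G) (e : E), Γ.start o (g • e) = g • Γ.start o e) (g : G) (v : V)
    (x : Bool → E → ℂ) (e : E) :
    Γ.atVertex o (g • v) x (g • e) = Γ.atVertex o v (fun b e => x b (g • e)) e := by
  unfold atVertex
  rw [ho, smul_left_cancel_iff]

theorem IsSymmetry.vertexCondition_atVertex_smul (hΓ : Γ.IsSymmetry G)
    (ho : ∀ (g : G) (e : E), Γ.start o (g • e) = g • Γ.start o e) (g : G) (v : V)
    (x y : Bool → E → ℂ) :
    Γ.VertexCondition (g • v) (Γ.atVertex o (g • v) x) (Γ.atVertex o (g • v) y) ↔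
      Γ.VertexCondition v (Γ.atVertex o v fun b e => x b (g • e))
        (Γ.atVertex o v fun b e => y b (g • e)) := by
  rw [hΓ.vertexCondition_smul]
  simp only [atVertex_smul ho]

theorem IsSymmetry.endCondition_smul (hΓ : Γ.IsSymmetry G)
    (ho : ∀ (g : G) (e : E), Γ.start o (g • e) = g • Γ.start o e) (g : G) {x y : Bool → E → ℂ}
    (h : Γ.EndCondition o x y) :
    Γ.EndCondition o (fun b e => x b (g • e)) (fun b e => y b (g • e)) := fun v =>
  (hΓ.vertexCondition_atVertex_smul ho g v x y).mp (h (g • v))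

end symmetry

/-! ### Vertex conditions for families depending linearly on a vector -/

section submodules

variable {V E W : Type*} (Γ : QuantumGraph V E) [Finite E] [AddCommGroup W] [Module ℂ W]

/-- The vectors which are mapped to families satisfying the condition at the vertex `v`. -/
def vertexSubmodule (v : V) (X Y : W →ₗ[ℂ] E → ℂ) : Submodule ℂ W where
  carrier := {w | Γ.VertexCondition v (X w) (Y w)}
  add_mem' h h' := by
    simp only [Set.mem_ofPred_eq, map_add]
    exact h.add h'
  zero_mem' := by
    simp only [Set.mem_ofPred_eq, map_zero]
    unfold VertexCondition
    simp only [Pi.zero_apply]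
    change (Γ.A v).mulVec 0 + (Γ.B v).mulVec 0 = 0
    rw [Matrix.mulVec_zero, Matrix.mulVec_zero, add_zero]
  smul_mem' c w h := by
    simp only [Set.mem_ofPred_eq, map_smul]
    exact h.smul c

open Classical in
/-- `QuantumGraph.atVertex` for families depending linearly on a vector. -/
def atVertexLinear (o : E → Bool) (v : V) (X : Bool → W →ₗ[ℂ] E → ℂ) : W →ₗ[ℂ] E → ℂ :=
  LinearMap.pi fun e => LinearMap.proj e ∘ₗ (if Γ.start o e = v then X false else X true)

omit [Finite E] in
theorem atVertexLinear_apply (o : E → Bool) (v : V) (X : Bool → W →ₗ[ℂ] E → ℂ) (w : W) :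
    Γ.atVertexLinear o v X w = Γ.atVertex o v fun b => X b w := by
  funext e
  simp only [atVertexLinear, atVertex, LinearMap.pi_apply, LinearMap.comp_apply,
    LinearMap.proj_apply]
  split_ifs <;> rfl

/-- The vectors which are mapped to families satisfying all vertex conditions. -/
def endSubmodule (o : E → Bool) (X Y : Bool → W →ₗ[ℂ] E → ℂ) : Submodule ℂ W :=
  ⨅ v, Γ.vertexSubmodule v (Γ.atVertexLinear o v X) (Γ.atVertexLinear o v Y)

variable {Γ}

theorem mem_endSubmodule {o : E → Bool} {X Y : Bool → W →ₗ[ℂ] E → ℂ} {w : W} :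
    w ∈ Γ.endSubmodule o X Y ↔ Γ.EndCondition o (fun b => X b w) (fun b => Y b w) := by
  rw [endSubmodule, Submodule.mem_iInf]
  refine forall_congr' fun v => ?_
  change Γ.VertexCondition v _ _ ↔ _
  rw [atVertexLinear_apply, atVertexLinear_apply]

end submodules

namespace QuotientChoice

/-! ### The vertex conditions of the quotient -/

variable {V E : Type*} {Γ : QuantumGraph V E} {H W : Type*} [Group H] [MulAction H V]
  [MulAction H E] [AddCommGroup W] [Module ℂ W] {ρ : Representation ℂ H W}
  (c : Γ.QuotientChoice ρ) [Finite E]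

theorem incident_mk (hΓ : Γ.IsSymmetry H) {k : MulAction.orbitRel.Quotient H V}
    (e : Γ.Incident (c.vertexRep k)) (j : Fin (c.copies (Quotient.mk'' e.1))) :
    c.edgeSrc ⟨Quotient.mk'' e.1, j⟩ = k ∨ c.edgeTgt ⟨Quotient.mk'' e.1, j⟩ = k := by
  have hv : ∀ (g : H) {v : V}, g • v = c.vertexRep k →
      (Quotient.mk'' v : MulAction.orbitRel.Quotient H V) = k := fun g v h => by
    rw [← c.mk_vertexRep k, ← h]
    exact (Quotient.sound ⟨g, rfl⟩ : (Quotient.mk'' (g • v) : MulAction.orbitRel.Quotient H V) = _).symm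
  have h := hΓ.src_smul_or (c.mover e.1) (c.edgeRep (Quotient.mk'' e.1))
  rw [mover_smul] at h
  rcases h with ⟨h1, h2⟩ | ⟨h1, h2⟩ <;> rcases e.2 with h3 | h3
  · exact Or.inl (hv _ (h1.symm.trans h3))
  · exact Or.inr (hv _ (h2.symm.trans h3))
  · exact Or.inr (hv _ (h1.symm.trans h3))
  · exact Or.inl (hv _ (h2.symm.trans h3))

variable [FiniteDimensional ℂ W]

theorem theta_mulVec_castLE (hΓ : Γ.IsSymmetry H) {k : MulAction.orbitRel.Quotient H V}
    [Fintype (c.Incident k)] (x : c.Edge → ℂ) (e : Γ.Incident (c.vertexRep k))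
    (j : Fin (c.copies (Quotient.mk'' e.1))) :
    (c.theta k).mulVec (fun e => x e.1) (e, Fin.castLE (c.copies_le _) j) =
      x ⟨Quotient.mk'' e.1, j⟩ := by
  rw [Matrix.mulVec, dotProduct, Finset.sum_eq_single ⟨⟨Quotient.mk'' e.1, j⟩, c.incident_mk hΓ e j⟩]
  · simp [theta]
  · rintro ⟨⟨i, j'⟩, h⟩ - hne
    have h1 : ¬ ((Quotient.mk'' e.1 : MulAction.orbitRel.Quotient H E) = i ∧ (j : ℕ) = j') := by
      rintro ⟨rfl, h2⟩
      exact hne (by rw [Subtype.mk.injEq, Fin.ext h2])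
    simp only [theta, Matrix.of_apply, Fin.val_castLE]
    rw [if_neg h1, zero_mul]
  · exact fun h => absurd (Finset.mem_univ _) h

omit [Finite E] [FiniteDimensional ℂ W] in
theorem theta_mulVec_of_le {k : MulAction.orbitRel.Quotient H V} [Fintype (c.Incident k)]
    (x : c.Edge → ℂ) (e : Γ.Incident (c.vertexRep k)) {j : Fin (Module.finrank ℂ W)}
    (hj : c.copies (Quotient.mk'' e.1) ≤ (j : ℕ)) :
    (c.theta k).mulVec (fun e => x e.1) (e, j) = 0 := by
  refine Finset.sum_eq_zero ?_
  rintro ⟨⟨i, j'⟩, h⟩ -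
  have h1 : ¬ ((Quotient.mk'' e.1 : MulAction.orbitRel.Quotient H E) = i ∧ (j : ℕ) = j') := by
    rintro ⟨rfl, h2⟩
    have := j'.2
    omega
  simp only [theta, Matrix.of_apply]
  rw [if_neg h1, zero_mul]

variable [Finite H]

/-- Θ places x in the coordinates belonging to fixed vectors and zero elsewhere; the transposed
block pairs this with the coordinates of ρ(g⁻¹)b_j in B^ν. That sum is the definition of `extend`.
-/
theorem repMatrix_mulVec_theta (hΓ : Γ.IsSymmetry H) {k : MulAction.orbitRel.Quotient H V}
    [Fintype (c.Incident k)] (x : c.Edge → ℂ) (e : Γ.Incident (c.vertexRep k))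
    (j : Fin (Module.finrank ℂ W)) :
    (c.repMatrix k).mulVec ((c.theta k).mulVec fun e => x e.1) (e, j) =
      c.extend x (c.basis j) e.1 := by
  rw [c.extend_of_smul_eq x _ (c.transporter_smul k e), Matrix.mulVec, dotProduct,
    Fintype.sum_prod_type, Finset.sum_eq_single e]
  · symm
    refine Fintype.sum_of_injective (Fin.castLE (c.copies_le _)) (Fin.castLE_injective _) _ _
      (fun j' hj' => ?_) fun j' => ?_
    · rw [c.theta_mulVec_of_le x e, mul_zero]
      by_contra h
      exact hj' ⟨⟨j', not_le.mp h⟩, rfl⟩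
    · rw [c.theta_mulVec_castLE hΓ x e j', mul_comm]
      simp [repMatrix, LinearMap.toMatrix_apply, fixedCoord]
  · intro e' _ he'
    refine Finset.sum_eq_zero fun j' _ => ?_
    simp [repMatrix, he']
  · exact fun h => absurd (Finset.mem_univ _) h

theorem boundaryMatrix_mulVec (hΓ : Γ.IsSymmetry H) (k : MulAction.orbitRel.Quotient H V)
    [Fintype (c.Incident k)] {n : ℕ} (M : Matrix (Fin n) (Γ.Incident (c.vertexRep k)) ℂ)
    (x : c.Edge → ℂ) (p : Fin n × Fin (Module.finrank ℂ W)) :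
    (c.boundaryMatrix k M).mulVec (fun e => x e.1) p =
      M.mulVec (fun e => c.extend x (c.basis p.2) e.1) p.1 := by
  rw [boundaryMatrix, ← Matrix.mulVec_mulVec, ← Matrix.mulVec_mulVec]
  rw [Matrix.mulVec, dotProduct, Fintype.sum_prod_type, Matrix.mulVec, dotProduct]
  refine Finset.sum_congr rfl fun e _ => ?_
  rw [Finset.sum_eq_single p.2]
  · rw [c.repMatrix_mulVec_theta hΓ]
    simp
  · intro j _ hj
    simp [Matrix.one_apply_ne hj.symm]
  · exact fun h => absurd (Finset.mem_univ _) h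

/-- Row (r, j) is the r-th condition of Γ applied to the extension at b_j. Linearity replaces the
basis vectors by all w. -/
theorem vertexCondition_quotientGraph (hΓ : Γ.IsSymmetry H) (s : c.RowChoice)
    (k : MulAction.orbitRel.Quotient H V) (x y : c.Edge → ℂ) :
    (c.quotientGraph hΓ s).VertexCondition k x y ↔
      ∀ w, Γ.VertexCondition (c.vertexRep k) (c.extend x w) (c.extend y w) := by
  let _ : Fintype (c.Incident k) := Fintype.ofFinite _
  let F : (c.Incident k → ℂ) × (c.Incident k → ℂ) →ₗ[ℂ] ℂ :=
    (dotProductBilin ℂ ℂ).flip (fun e => x e.1) ∘ₗ LinearMap.fst ℂ _ _ +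
      (dotProductBilin ℂ ℂ).flip (fun e => y e.1) ∘ₗ LinearMap.snd ℂ _ _
  have hF : ∀ p, F (c.boundaryRow k p) =
      ((Γ.A (c.vertexRep k)).mulVec (fun e => c.extend x (c.basis p.2) e.1) +
        (Γ.B (c.vertexRep k)).mulVec (fun e => c.extend y (c.basis p.2) e.1)) p.1 := fun p => by
    rw [Pi.add_apply, ← c.boundaryMatrix_mulVec hΓ k _ x p, ← c.boundaryMatrix_mulVec hΓ k _ y p]
    rfl
  have h1 : (c.quotientGraph hΓ s).VertexCondition k x y ↔
      ∀ r, F (c.boundaryRow k (s.row k r)) = 0 := funext_iff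
  -- Vanishing of F on a set of rows depends only on their span, so eliminating redundant rows is
  -- harmless.
  have h2 : (∀ r, F (c.boundaryRow k (s.row k r)) = 0) ↔ ∀ p, F (c.boundaryRow k p) = 0 := by
    have h3 : ∀ {ι : Type} (a : ι → (c.Incident k → ℂ) × (c.Incident k → ℂ)),
        (∀ i, F (a i) = 0) ↔ Submodule.span ℂ (Set.range a) ≤ LinearMap.ker F := fun a => by
      rw [Submodule.span_le, Set.range_subset_iff]
      rfl
    rw [h3 fun r => c.boundaryRow k (s.row k r), s.span_eq, ← h3]
  rw [h1, h2]
  constructor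
  · intro h
    have h4 : Submodule.span ℂ (Set.range c.basis) ≤
        Γ.vertexSubmodule (c.vertexRep k) (c.extend x) (c.extend y) := by
      rw [Submodule.span_le, Set.range_subset_iff]
      exact fun j => funext fun r => (hF (r, j)).symm.trans (h (r, j))
    rw [c.basis.span_eq] at h4
    exact fun w => h4 Submodule.mem_top
  · exact fun h p => (hF p).trans (congrFun (h (c.basis p.2)) p.1)

/-- The direction of the edges of the quotient induced by a direction of the edges of `Γ`. -/
def direction (o : E → Bool) (e : c.Edge) : Bool := o (c.edgeRep e.1)

-- All copies of an edge start at v_k exactly when the edge itself starts at ṽ_k, so selecting the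
-- end commutes with extending.
omit [Finite H] in
theorem extend_atVertex (hΓ : Γ.IsSymmetry H) (s : c.RowChoice) {o : E → Bool}
    (ho : ∀ (g : H) (e : E), Γ.start o (g • e) = g • Γ.start o e)
    (k : MulAction.orbitRel.Quotient H V) (x : Bool → c.Edge → ℂ) (w : W) {e : E}
    (he : Γ.src e = c.vertexRep k ∨ Γ.tgt e = c.vertexRep k) :
    c.extend ((c.quotientGraph hΓ s).atVertex (c.direction o) k x) w e =
      Γ.atVertex o (c.vertexRep k) (fun b => c.extend (x b) w) e := by
  have h1 : ∀ j, (c.quotientGraph hΓ s).start (c.direction o) ⟨Quotient.mk'' e, j⟩ = k ↔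
      Γ.start o e = c.vertexRep k := fun j => by
    have h2 : (c.quotientGraph hΓ s).start (c.direction o) ⟨Quotient.mk'' e, j⟩ =
        Quotient.mk'' (Γ.start o (c.edgeRep (Quotient.mk'' e))) := by
      unfold start direction
      split_ifs <;> rfl
    have h3 : (Quotient.mk'' (Γ.start o e) : MulAction.orbitRel.Quotient H V) =
        Quotient.mk'' (Γ.start o (c.edgeRep (Quotient.mk'' e))) := by
      conv_lhs => rw [← c.mover_smul e, ho]
      exact Quotient.sound ⟨c.mover e, rfl⟩
    rw [h2, ← h3]
    constructor
    · intro h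
      rw [← c.mk_vertexRep k] at h
      obtain ⟨g, hg⟩ := MulAction.orbitRel_apply.mp (Quotient.exact h.symm)
      exact hΓ.start_eq_of_smul_eq he hg
    · intro h
      rw [h, c.mk_vertexRep]
  simp only [extend_apply, atVertex]
  split_ifs with h
  · exact Finset.sum_congr rfl fun j _ => by rw [if_pos ((h1 j).mpr h)]
  · exact Finset.sum_congr rfl fun j _ => by rw [if_neg fun h2 => h ((h1 j).mp h2)]

theorem endCondition_quotientGraph (hΓ : Γ.IsSymmetry H) (s : c.RowChoice) {o : E → Bool}
    (ho : ∀ (g : H) (e : E), Γ.start o (g • e) = g • Γ.start o e) (x y : Bool → c.Edge → ℂ) :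
    (c.quotientGraph hΓ s).EndCondition (c.direction o) x y ↔
      ∀ w, Γ.EndCondition o (fun b => c.extend (x b) w) (fun b => c.extend (y b) w) := by
  have h1 : ∀ k, (c.quotientGraph hΓ s).VertexCondition k
      ((c.quotientGraph hΓ s).atVertex (c.direction o) k x)
      ((c.quotientGraph hΓ s).atVertex (c.direction o) k y) ↔
      ∀ w, Γ.VertexCondition (c.vertexRep k)
        (Γ.atVertex o (c.vertexRep k) fun b => c.extend (x b) w)
        (Γ.atVertex o (c.vertexRep k) fun b => c.extend (y b) w) := fun k => by
    rw [c.vertexCondition_quotientGraph hΓ s k]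
    refine forall_congr' fun w => ?_
    exact VertexCondition.congr (fun e he => c.extend_atVertex hΓ s ho k x w he)
      fun e he => c.extend_atVertex hΓ s ho k y w he
  refine ⟨fun h w v => ?_, fun h k => (h1 k).mpr fun w => h w _⟩
  -- The quotient imposes conditions only at representatives; at g • ṽ_k the condition for w is the
  -- condition at ṽ_k for ρ(g⁻¹)w.
  obtain ⟨k, g, rfl⟩ : ∃ (k : _) (g : H), g • c.vertexRep k = v :=
    ⟨Quotient.mk'' v, Quotient.exact (c.mk_vertexRep (Quotient.mk'' v)).symm⟩
  rw [hΓ.vertexCondition_atVertex_smul ho]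
  have h2 : ∀ z : Bool → c.Edge → ℂ, (fun b => c.extend (z b) (ρ g⁻¹ w)) =
      fun b e => c.extend (z b) w (g • e) := fun z => funext fun b => funext fun e => by
    rw [← c.extend_mem (z b) g (ρ g⁻¹ w) e, Representation.self_inv_apply]
  have h3 := (h1 k).mp (h k) (ρ g⁻¹ w)
  rwa [h2 x, h2 y] at h3

end QuotientChoice

end QuantumGraph

end

noncomputable section

namespace QuantumGraph

namespace QuotientChoice

/-! ### Quotients by representations of subgroups -/

variable {V E : Type*} {Γ : QuantumGraph V E} {G : Type*} [Group G] [Finite G] [MulAction G V]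
  [MulAction G E] {H : Subgroup G} {W : Type*} [AddCommGroup W] [Module ℂ W]
  [FiniteDimensional ℂ W] {ρ : Representation ℂ H W} (c : Γ.QuotientChoice ρ)

/-- The functions on the edges of the quotient correspond to the equivariant maps from the induced
representation to the functions on the edges of `Γ`. -/
def inducedEquiv : (c.Edge → ℂ) ≃ₗ[ℂ] (ρ.ind H.subtype).equivariantMaps E :=
  c.edgeEquiv ≪≫ₗ Representation.frobeniusEquiv ρ E

theorem inducedEquiv_mk (x : c.Edge → ℂ) (g : G) (w : W) (e : E) :
    (c.inducedEquiv x).1 (Representation.IndV.mk H.subtype ρ g w) e = c.extend x w (g • e) :=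
  Representation.frobeniusEquiv_mk _ g w e

variable [Finite E]

theorem inducedEquiv_len (hΓ : Γ.IsSymmetry G) (x : c.Edge → ℂ)
    (z : Representation.IndV H.subtype ρ) (e : E) :
    (c.inducedEquiv fun e => (Γ.len (c.edgeRep e.1) : ℂ) * x e).1 z e =
      (Γ.len e : ℂ) * (c.inducedEquiv x).1 z e := by
  have h : (c.inducedEquiv fun e => (Γ.len (c.edgeRep e.1) : ℂ) * x e).1 =
      LinearMap.mulLeft ℂ (fun e => (Γ.len e : ℂ)) ∘ₗ (c.inducedEquiv x).1 := by
    refine Representation.IndV.hom_ext_apply fun g w e => ?_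
    have h1 : Γ.len (c.edgeRep (Quotient.mk'' (g • e))) = Γ.len e := by
      have h2 := (hΓ.subgroup H).len_smul (c.mover (g • e)) (c.edgeRep (Quotient.mk'' (g • e)))
      rw [mover_smul, hΓ.len_smul] at h2
      exact h2.symm
    refine (c.inducedEquiv_mk _ g w e).trans ?_
    refine Eq.trans ?_ (congrArg ((Γ.len e : ℂ) * ·) (c.inducedEquiv_mk x g w e)).symm
    simp only [extend_apply, h1, Finset.mul_sum, mul_assoc]
  rw [h]
  rfl

/-- On a generator g ⊗ w the data are those of w translated by g, and the conditions of Γ are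
G-invariant. The admissible z form a subspace containing the generators, hence everything. -/
theorem endCondition_inducedEquiv (hΓ : Γ.IsSymmetry G) (s : c.RowChoice) {o : E → Bool}
    (ho : ∀ (g : G) (e : E), Γ.start o (g • e) = g • Γ.start o e) (x y : Bool → c.Edge → ℂ) :
    (c.quotientGraph (hΓ.subgroup H) s).EndCondition (c.direction o) x y ↔
      ∀ z, Γ.EndCondition o (fun b => (c.inducedEquiv (x b)).1 z)
        (fun b => (c.inducedEquiv (y b)).1 z) := by
  rw [c.endCondition_quotientGraph (hΓ.subgroup H) s (fun g e => ho g e)]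
  have h1 : ∀ (z : Bool → c.Edge → ℂ) (g : G) (w : W),
      (fun b => (c.inducedEquiv (z b)).1 (Representation.IndV.mk H.subtype ρ g w)) =
        fun b e => c.extend (z b) w (g • e) := fun z g w =>
    funext fun b => funext fun e => c.inducedEquiv_mk (z b) g w e
  constructor
  · intro h z
    have h2 : Γ.endSubmodule o (fun b => (c.inducedEquiv (x b)).1)
        (fun b => (c.inducedEquiv (y b)).1) = ⊤ :=
      Representation.eq_top_of_mk_mem fun g w => by
        rw [mem_endSubmodule, h1 x, h1 y]
        exact hΓ.endCondition_smul ho g (h w)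
    exact mem_endSubmodule.mp (h2 ▸ Submodule.mem_top)
  · intro h w
    have h2 := h (Representation.IndV.mk H.subtype ρ 1 w)
    rw [h1 x, h1 y] at h2
    simpa only [one_smul] using h2

end QuotientChoice

end QuantumGraph

end

/-! ### The transplantation theorem -/

theorem mainTheorem5 {V E G : Type*} [Finite V] [Finite E] [Group G] [Finite G]
    [MulAction G V] [MulAction G E] (Γ : QuantumGraph V E) (hΓ : Γ.IsSymmetry G)
    (H₁ H₂ : Subgroup G)
    {W₁ W₂ : Type*} [AddCommGroup W₁] [Module ℂ W₁] [FiniteDimensional ℂ W₁]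
    [AddCommGroup W₂] [Module ℂ W₂] [FiniteDimensional ℂ W₂]
    (R₁ : Representation ℂ H₁ W₁) (R₂ : Representation ℂ H₂ W₂)
    (hInd : Nonempty
      (Representation.Equiv (R₁.ind H₁.subtype) (R₂.ind H₂.subtype)))
    (c₁ : Γ.QuotientChoice R₁) (s₁ : c₁.RowChoice)
    (c₂ : Γ.QuotientChoice R₂) (s₂ : c₂.RowChoice) :
    QuantumGraph.Transplantable (c₁.quotientGraph (hΓ.subgroup H₁) s₁)
      (c₂.quotientGraph (hΓ.subgroup H₂) s₂) := by
  obtain ⟨α⟩ := hInd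
  obtain ⟨o, ho⟩ := hΓ.exists_start_smul
  let L : (c₁.Edge → ℂ) ≃ₗ[ℂ] (c₂.Edge → ℂ) := c₁.inducedEquiv ≪≫ₗ
    Representation.equivariantMapsCongr α E ≪≫ₗ c₂.inducedEquiv.symm
  -- Up to the identification α, x and L x define the same equivariant map; lengths and conditions
  -- are compared through it.
  have hL : ∀ x z, (c₂.inducedEquiv (L x)).1 (α.toLinearEquiv z) = (c₁.inducedEquiv x).1 z := by
    intro x z
    simp only [L, LinearEquiv.trans_apply, LinearEquiv.apply_symm_apply]
    exact Representation.equivariantMapsCongr_apply α _ z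
  refine QuantumGraph.transplantable_of_linearEquiv (c₁.direction o) (c₂.direction o) L ?_ ?_
  · intro x
    refine c₂.inducedEquiv.injective (Subtype.ext (LinearMap.ext fun z => ?_))
    obtain ⟨z, rfl⟩ := α.toLinearEquiv.surjective z
    funext e
    refine (congrFun (hL _ z) e).trans ?_
    refine (c₁.inducedEquiv_len hΓ x z e).trans ?_
    refine Eq.trans ?_ (c₂.inducedEquiv_len hΓ (L x) _ e).symm
    rw [hL]
  · intro x y
    rw [c₁.endCondition_inducedEquiv hΓ s₁ ho, c₂.endCondition_inducedEquiv hΓ s₂ ho,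
      α.toLinearEquiv.surjective.forall]
    simp only [hL]
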